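/- Let $p$ be a prime, $F$ a number field with ring of integers $\mathcal O_F$, $E/\mathbf Q_p$ a finite extension with valuation ring $\mathcal O$, and $n\ge 1$. Let $G=\mathrm{Res}_{\mathcal O_F/\mathbf Z}(\mathrm{GL}_{n+1}\times\mathrm{GL}_n)$, so that $G(A)=\mathrm{GL}_{n+1}(A\otimes_{\mathbf Z}\mathcal O_F)\times\mathrm{GL}_n(A\otimes_{\mathbf Z}\mathcal O_F)$ for every commutative ring $A$. Let $B=TU$ and $B^-=TU^-$ be the upper and lower triangular Borel subgroups (with $T$ the diagonal torus and $U,U^-$ the unipotent radicals), $w_0$ the longest Weyl element, and let $\Delta(g)=(\mathrm{diag}(g,1),g)$ be the embedding of $\mathrm{Res}_{\mathcal O_F/\mathbf Z}\mathrm{GL}_n$ into $G$, with image $H$ and norm character $N_H(\Delta(g))=N_{F/\mathbf Q}(\det g)$. Put $t_a=\mathrm{diag}(a^n,a^{n-1},\dots,a)\in\mathrm{GL}_n$, regarded also as the element $\Delta(t_a)$ of $T$; $d_x=\Delta(\mathrm{diag}(x,1,\dots,1))$; and $g_0=h=(h_n\cdot\mathrm{diag}(t_{-1},1),\,\mathbf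 1_n)$, where $h_n\in\mathrm{GL}_{n+1}(\mathbf Z)$ has the antidiagonal permutation matrix $w_n$ as its upper left $n\times n$ block, last column $(1,\dots,1)^t$ and last row $(0,\dots,0,1)$. Let $L_{\lambda,E}$ be the irreducible rational representation of $G$ over $E$ of $B$-highest weight $\lambda$, and let $v_0\in L_{\lambda,E}$ be a highest weight vector with respect to $B^-$, i.e. $v_0\ne 0$ is fixed by $U^-$ and $T$ acts on it through $\lambda^{w_0}$. Let $L_{\lambda,\mathcal O}$ be the $G(\mathcal O)$-lattice generated by $v_0$, i.e. the $\mathcal O$-span of $G(\mathcal O)v_0$. For $t\in T(E)$ put $t\bullet v=\lambda^{w_0}(t)^{-1}\,tv$, and for $x\in(\mathcal O\otimes_{\mathbf Z}\mathcal O_F)^\times$ (for example $x\in\mathcal O^\times$) and $\alpha\in\mathbf Z_{\ge0}$ put $$L_{\lambda,\mathcal O}^{x,\alpha}=d_x h\cdot\bigl(t_p^\alpha\bullet L_{\lambda,\mathcal O}\bigr).$$ For $j\in\mathbf Z$ let $E_{(j)}=E$ with $H$ acting through $N_H^j$. Then for all $x\in(\mathcal O\otimes\mathcal O_F)^\times$,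 $\alpha\ge0$ and $v\in L_{\lambda,\mathcal O}^{x,\alpha}$ there is a constant $\Omega_p^{\alpha,v}\in\mathcal O$ such that, for every $j\in\mathbf Z$ and every non-zero $H$-equivariant functional $\eta_j:L_{\lambda,E}\to E_{(j)}$, $$\eta_j(g_0v_0)\ne0\quad\text{and}\quad \eta_j(v)\equiv N_{F/\mathbf Q}(x)^j\,\Omega_p^{\alpha,v}\,\eta_j(g_0v_0)\pmod{\mathcal O\cdot p^\alpha\eta_j(g_0v_0)},$$ where $N_{F/\mathbf Q}(x)$ is the norm of $x$ from $\mathcal O\otimes\mathcal O_F$ to $\mathcal O$. Moreover $\Omega_p^{\alpha,v}=1$ if $v=d_x h v_0$. -/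

import Mathlib

open scoped TensorProduct NumberField

namespace ManinCongruence

noncomputable section

/-! ### The groups

`G = Res (GL(n+1) × GL(n))` is the restriction of scalars from `𝓞 F` to `ℤ`. Its group of points
over a commutative ring `A` consists of pairs of invertible matrices over `A ⊗ 𝓞 F`. -/

/-- The coefficient ring `A ⊗ 𝓞 F` of the `A`-valued points of `G`. -/
abbrev Coeff (F A : Type*) [Field F] [CommRing A] : Type _ := A ⊗[ℤ] (𝓞 F)

/-- `GL(n+1, R) × GL(n, R)`. -/
abbrev GLPair (n : ℕ) (R : Type*) [CommRing R] : Type _ := GL (Fin (n + 1)) R × GL (Fin n) R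

/-- `G(A) = GL(n+1, A ⊗ 𝓞 F) × GL(n, A ⊗ 𝓞 F)`. -/
abbrev GPoints (n : ℕ) (F A : Type*) [Field F] [CommRing A] : Type _ := GLPair n (Coeff F A)

/-- The base change map `A ⊗ 𝓞 F → B ⊗ 𝓞 F` of a ring homomorphism `A → B`. -/
def coeffMap (F : Type*) {A B : Type*} [Field F] [CommRing A] [CommRing B] (f : A →+* B) :
    Coeff F A →+* Coeff F B :=
  (Algebra.TensorProduct.map f.toIntAlgHom (AlgHom.id ℤ (𝓞 F))).toRingHom

/-- The map `G(A) → G(B)` induced by a ring homomorphism `A → B`. -/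
def pointsMap (n : ℕ) (F : Type*) {A B : Type*} [Field F] [CommRing A] [CommRing B]
    (f : A →+* B) : GPoints n F A →* GPoints n F B :=
  (Matrix.GeneralLinearGroup.map (coeffMap F f)).prodMap
    (Matrix.GeneralLinearGroup.map (coeffMap F f))

section Matrices

variable {n : ℕ} {R : Type*} [CommRing R]

/-- Block matrices of size `n + 1`, with blocks of sizes `n` and `1`. -/
def blocks (a : Matrix (Fin n) (Fin n) R) (b : Matrix (Fin n) (Fin 1) R)
    (c : Matrix (Fin 1) (Fin n) R) (d : Matrix (Fin 1) (Fin 1) R) :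
    Matrix (Fin (n + 1)) (Fin (n + 1)) R :=
  Matrix.reindex finSumFinEquiv finSumFinEquiv (Matrix.fromBlocks a b c d)

theorem blocks_mul (a a' : Matrix (Fin n) (Fin n) R) (b b' : Matrix (Fin n) (Fin 1) R)
    (c c' : Matrix (Fin 1) (Fin n) R) (d d' : Matrix (Fin 1) (Fin 1) R) :
    blocks a b c d * blocks a' b' c' d' =
      blocks (a * a' + b * c') (a * b' + b * d') (c * a' + d * c') (c * b' + d * d') := by
  simp only [blocks, Matrix.reindex_apply, Matrix.submatrix_mul_equiv, Matrix.fromBlocks_multiply]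

theorem blocks_one : blocks (1 : Matrix (Fin n) (Fin n) R) 0 0 1 = 1 := by
  simp only [blocks, Matrix.fromBlocks_one, Matrix.reindex_apply, Matrix.submatrix_one_equiv]

/-- The embedding `j_n : GL(n) → GL(n+1)`, `g ↦ diag(g, 1)`. -/
def jHom : GL (Fin n) R →* GL (Fin (n + 1)) R :=
  Units.map
    { toFun := fun g => blocks g 0 0 1
      map_one' := blocks_one
      map_mul' := fun g g' => by simp [blocks_mul] }

/-- The diagonal embedding `Δ = j_n × 1` of `H = Res GL(n)` into `G`. -/
def deltaHom : GL (Fin n) R →* GLPair n R := jHom.prod (MonoidHom.id _)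

/-- The diagonal matrix with the given invertible entries. -/
def diagHom {m : ℕ} : (Fin m → Rˣ) →* GL (Fin m) R :=
  (Units.map (Matrix.diagonalRingHom (Fin m) R).toMonoidHom).comp
    (MulEquiv.piUnits (M := fun _ : Fin m => R)).symm.toMonoidHom

/-- The matrix `w_n` with ones on the antidiagonal and zeros elsewhere. -/
def wMatrix (n : ℕ) (R : Type*) [CommRing R] : Matrix (Fin n) (Fin n) R :=
  Matrix.of fun i j => if j = i.rev then 1 else 0

/-- The column of ones. -/
def onesCol (n : ℕ) (R : Type*) [CommRing R] : Matrix (Fin n) (Fin 1) R :=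
  Matrix.of fun _ _ => 1

theorem wMatrix_mul_self : wMatrix n R * wMatrix n R = 1 := by
  ext i j
  simp only [wMatrix, Matrix.mul_apply, Matrix.of_apply, Matrix.one_apply, ite_mul, one_mul,
    zero_mul, Finset.sum_ite_eq', Finset.mem_univ, if_true, Fin.rev_rev]
  simp only [eq_comm]

theorem wMatrix_mul_onesCol : wMatrix n R * onesCol n R = onesCol n R := by
  ext i j
  simp [wMatrix, onesCol, Matrix.mul_apply]

/-- The matrix `h_n`, with upper left block `w_n`, last column `(1, …, 1)` and
last row `(0, …, 0, 1)`. -/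
def hGL (n : ℕ) (R : Type*) [CommRing R] : GL (Fin (n + 1)) R where
  val := blocks (wMatrix n R) (onesCol n R) 0 1
  inv := blocks (wMatrix n R) (-onesCol n R) 0 1
  val_inv := by
    simp [blocks_mul, wMatrix_mul_self, wMatrix_mul_onesCol, blocks_one]
  inv_val := by
    simp [blocks_mul, wMatrix_mul_self, wMatrix_mul_onesCol, blocks_one]

/-- The entries `(x^n, x^(n-1), …, x)` of the diagonal matrix `t_x`. -/
def tEntries (n : ℕ) (x : Rˣ) : Fin n → Rˣ := fun i => x ^ (n - (i : ℕ))

/-- The element `h = (h_n j_n(t_{-1}), 1)` of `G`; it is also the element `g_0`. -/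
def hElement (n : ℕ) (R : Type*) [CommRing R] : GLPair n R :=
  (hGL n R * jHom (diagHom (tEntries n (-1))), 1)

/-- The element `d_x = Δ(diag(x, 1, …, 1))` of `G`. -/
def dElement (n : ℕ) (x : Rˣ) : GLPair n R :=
  deltaHom (diagHom fun i : Fin n => if (i : ℕ) = 0 then x else 1)

/-! ### The torus, the unipotent radicals -/

/-- The points of the diagonal torus `T` of `G`. -/
abbrev Torus (n : ℕ) (R : Type*) [CommRing R] : Type _ := (Fin (n + 1) → Rˣ) × (Fin n → Rˣ)

/-- The inclusion of the torus in `G`. -/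
def torusHom : Torus n R →* GLPair n R := diagHom.prodMap diagHom

/-- The element `t_x`, diagonally embedded in the torus of `G`. -/
def tElement (n : ℕ) (x : Rˣ) : Torus n R := (Fin.snoc (tEntries n x) 1, tEntries n x)

theorem torusHom_tElement (x : Rˣ) :
    torusHom (tElement n x) = deltaHom (diagHom (tEntries n x)) := by
  refine Prod.ext ?_ rfl
  ext i j
  refine Fin.lastCases ?_ (fun i => ?_) i <;> refine Fin.lastCases ?_ (fun j => ?_) j <;>
    simp [torusHom, tElement, deltaHom, jHom, diagHom, blocks, Matrix.diagonal_apply,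
      finSumFinEquiv, Fin.addCases, Fin.ext_iff] <;>
    intros <;> omega

/-- Conjugation by the longest Weyl element `w_0 = (w_{n+1}, w_n)` on the torus. -/
def torusRev : Torus n R →* Torus n R where
  toFun t := (t.1 ∘ Fin.rev, t.2 ∘ Fin.rev)
  map_one' := rfl
  map_mul' _ _ := rfl

/-- Upper triangular matrices with ones on the diagonal. -/
def IsUpperUnipotent {m : ℕ} (g : GL (Fin m) R) : Prop :=
  ∀ i j, (i = j → g i j = 1) ∧ (j < i → g i j = 0)

/-- Lower triangular matrices with ones on the diagonal. -/
def IsLowerUnipotent {m : ℕ} (g : GL (Fin m) R) : Prop :=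
  ∀ i j, (i = j → g i j = 1) ∧ (i < j → g i j = 0)

end Matrices

/-! ### Rational representations

`E` is an infinite field, and `G_E` is an open subscheme of an affine space over `E`, so `G(E)` is
Zariski dense in `G_E`; hence regular functions, algebraic characters and rational representations
of `G_E` may be described on `E`-valued points. -/

section Rational

variable {n : ℕ} {F E V : Type*} [Field F] [Field E] [AddCommGroup V] [Module E V]

/-- The algebra of regular functions on `G_E`, as functions on `G(E)`. It is generated by the
`E`-linear coordinates of the entries of `g` and of `g⁻¹`. -/
def regularFunctions (n : ℕ) (F E : Type*) [Field F] [Field E] :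
    Subalgebra E (GPoints n F E → E) :=
  Algebra.adjoin E
    {f | ∃ l : Coeff F E →ₗ[E] E,
      (∃ i j, f = fun g => l (g.1 i j)) ∨ (∃ i j, f = fun g => l (g.1⁻¹ i j)) ∨
      (∃ i j, f = fun g => l (g.2 i j)) ∨ (∃ i j, f = fun g => l (g.2⁻¹ i j))}

/-- A representation of `G(E)` is rational if its matrix coefficients are regular functions. -/
def IsRational (ρ : Representation E (GPoints n F E) V) : Prop :=
  ∀ (v : V) (l : V →ₗ[E] E), (fun g => l (ρ g v)) ∈ regularFunctions n F E

/-- An algebraic character of the torus `T_E`: a character of `T(E)` that is the restriction of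
a regular function on `G_E` (note that `T_E` is closed in `G_E`). -/
structure Weight (n : ℕ) (F E : Type*) [Field F] [Field E] where
  /-- the underlying character -/
  toHom : Torus n (Coeff F E) →* Eˣ
  /-- the character is algebraic -/
  regular : ∃ f ∈ regularFunctions n F E, ∀ t, (toHom t : E) = f (torusHom t)

/-- The conjugate `λ^{w_0}` of the weight `λ` by the longest Weyl element. -/
def Weight.conj (wt : Weight n F E) : Torus n (Coeff F E) →* Eˣ := wt.toHom.comp torusRev

/-- `V` is the irreducible rational representation of `G` of `B`-highest weight `λ` over `E`:
it is irreducible and rational, and contains a nonzero vector that is fixed by `U` and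
on which `T` acts through `λ`. (Such a `λ` is automatically dominant.) -/
structure IsIrreducibleOfHighestWeight (ρ : Representation E (GPoints n F E) V)
    (wt : Weight n F E) : Prop where
  finite : FiniteDimensional E V
  rational : IsRational ρ
  irreducible : ρ.IsIrreducible
  exists_vector : ∃ v : V, v ≠ 0 ∧
    (∀ g : GPoints n F E, IsUpperUnipotent g.1 → IsUpperUnipotent g.2 → ρ g v = v) ∧
    ∀ t, ρ (torusHom t) v = (wt.toHom t : E) • v

/-- `v₀` is a highest weight vector with respect to the opposite Borel group `B⁻`: it is nonzero,
fixed by the unipotent radical of `B⁻`, and `T` acts on it through `λ^{w_0}`. -/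
structure IsOppositeHighestWeightVector (ρ : Representation E (GPoints n F E) V)
    (wt : Weight n F E) (v₀ : V) : Prop where
  ne_zero : v₀ ≠ 0
  unipotent : ∀ g : GPoints n F E, IsLowerUnipotent g.1 → IsLowerUnipotent g.2 → ρ g v₀ = v₀
  torus : ∀ t, ρ (torusHom t) v₀ = (wt.conj t : E) • v₀

/-- The normalized action `t • v = (-λ^{w_0})(t) · t v` of the torus. -/
def bullet (ρ : Representation E (GPoints n F E) V) (wt : Weight n F E)
    (t : Torus n (Coeff F E)) : V →ₗ[E] V :=
  (((wt.conj t)⁻¹ : Eˣ) : E) • ρ (torusHom t)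

/-- The norm character `N_H = N_{F/ℚ} ∘ det` on `H(E) = GL(n, E ⊗ 𝓞 F)`. Note that
`E ⊗ 𝓞 F = E ⊗_ℚ F` for a field `E` of characteristic zero. -/
def normH (g : GL (Fin n) (Coeff F E)) : E :=
  Algebra.norm E (Matrix.det (g : Matrix (Fin n) (Fin n) (Coeff F E)))

/-- `η : V → E_(j)` is `H`-equivariant, where `H` acts on `E_(j) = E` through `N_H^j`. -/
def IsEquivariant (ρ : Representation E (GPoints n F E) V) (j : ℤ) (η : V →ₗ[E] E) : Prop :=
  ∀ (g : GL (Fin n) (Coeff F E)) (v : V), η (ρ (deltaHom g) v) = normH g ^ j * η v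

end Rational

/-! ### Lattices -/

section Lattices

variable (p : ℕ) [Fact p.Prime] {n : ℕ} {F E V : Type*} [Field F] [Field E]
  [Algebra ℚ_[p] E] [Algebra ℤ_[p] E] [AddCommGroup V] [Module E V]

/-- The valuation ring `𝒪` of the finite extension `E` of `ℚ_p`: the integral closure of `ℤ_p`. -/
abbrev valuationRing (E : Type*) [Field E] [Algebra ℤ_[p] E] : Subalgebra ℤ_[p] E :=
  integralClosure ℤ_[p] E

/-- The inclusion `𝒪 ⊗ 𝓞 F → E ⊗ 𝓞 F`. -/
def integralCoeff (F E : Type*) [Field F] [Field E] [Algebra ℤ_[p] E] :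
    Coeff F (valuationRing p E) →+* Coeff F E :=
  coeffMap F (valuationRing p E).val.toRingHom

/-- The rational prime `p`, as a unit of `E ⊗ 𝓞 F`. -/
def pUnit (F E : Type*) [Field F] [Field E] [Algebra ℚ_[p] E] : (Coeff F E)ˣ :=
  Units.map ((algebraMap E (Coeff F E)).comp (algebraMap ℚ_[p] E)).toMonoidHom
    (Units.mk0 (p : ℚ_[p]) (Nat.cast_ne_zero.mpr (Fact.out : p.Prime).ne_zero))

/-- The `G(𝒪)`-lattice `L_𝒪` generated by `v₀`: the `𝒪`-span of the orbit `G(𝒪) v₀`. -/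
def lattice (ρ : Representation E (GPoints n F E) V) (v₀ : V) :
    Submodule (valuationRing p E) V :=
  Submodule.span (valuationRing p E)
    (Set.range fun g : GPoints n F (valuationRing p E) =>
      ρ (pointsMap n F (valuationRing p E).val.toRingHom g) v₀)

/-- The element `d_x` of `G(E)` attached to `x ∈ (𝒪 ⊗ 𝓞 F)ˣ`. -/
def dIntegral (n : ℕ) (x : (Coeff F (valuationRing p E))ˣ) : GPoints n F E :=
  dElement n (Units.map (integralCoeff p F E).toMonoidHom x)

/-- The translated lattice `L_𝒪^{x,α} = d_x h · (t_p^α • L_𝒪)`. -/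
def translatedLattice (ρ : Representation E (GPoints n F E) V) (wt : Weight n F E) (v₀ : V)
    (x : (Coeff F (valuationRing p E))ˣ) (α : ℕ) : Submodule (valuationRing p E) V :=
  (lattice p ρ v₀).map
    ((ρ (dIntegral p n x * hElement n (Coeff F E)) ∘ₗ
      bullet ρ wt (tElement n (pUnit p F E) ^ α)).restrictScalars (valuationRing p E))

/-- The norm `N_{F/ℚ}(x)` of `x ∈ (𝒪 ⊗ 𝓞 F)ˣ`, as an element of `E`. -/
def normX (x : (Coeff F (valuationRing p E))ˣ) : E :=
  Algebra.norm E (integralCoeff p F E (x : Coeff F (valuationRing p E)))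

end Lattices

end

end ManinCongruence

/-! Write A = E ⊗ 𝓞 F and R = 𝒪 ⊗ 𝓞 F, and let w be the antidiagonal permutation matrix. An
equivariant η gives the function Φ(Y) = η((Yw, 1) v₀) on GL(n+1, A) (`cellFunction`). Since η is
equivariant and v₀ is an eigenvector of B⁻, Φ is semi-invariant under the lower triangular Borel
group of GL(n) on the left and the upper triangular one of GL(n+1) on the right. These two groups
have an open orbit. It is the locus where the minors with columns 0, …, k and rows 0, …, k, or 0, …,
k-1, n, are units, and there Φ is a character of the minors times its value at the base point `rowGL
1`. Matrix coefficients are regular, so identities valid on the orbit hold everywhere. Consequently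
Φ does not vanish at the base point unless η = 0, the same is true at h because the minors of hw are
signs, and Φ is up to normalization a product of multiplicative functions of the minors
(`mul_sq_eq`).

By linearity it suffices to study g v₀ with g ∈ G(𝒪). Let t_s be the torus element of a scalar s.
After removing an element of H and a scalar, h t_s g becomes diag(g₂⁻¹, 1) D H D G₁ with D = diag(1,
s, …, sⁿ). Its minors are divisible by the power of s which, up to a sign, is the minor for g = 1,
and the quotients are polynomials in s over R (`exists_minor_contracted_eq`). So the ratio of the
values of Φ at g and at 1 is a product of multiplicative functions evaluated at polynomials over R.
All powers of such a value come from one regular function on curves over R, hence have a common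
denominator. The value is therefore almost integral, and it lies in 𝒪[s] because 𝒪 is Noetherian and
integrally closed (`exists_polynomial_of_pow`).

Thus η(h(t_s • g v₀)) = η(h v₀) P(s) with P ∈ 𝒪[s], and s = p^α gives P(0) modulo p^α. The constant
P(0) does not depend on η or j: V is spanned by U v₀ and t_s contracts U to 1, so t_s • w tends to a
multiple Ω v₀ as s → 0, and P(0) = Ω (`exists_limit`). Finally d_x contributes the factor N(x)^j,
which is integral. -/

set_option linter.unusedSectionVars false

namespace ManinCongruence

/-! ### Algebras of functions -/

section FunctionAlgebras

open Polynomial Filter Matrix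

variable {E X A : Type*} [Field E] [CommRing A] [Algebra E A]

/-- The `A`-valued functions all of whose `E`-linear coordinates lie in `S`. -/
def coordSubalgebra (A : Type*) [CommRing A] [Algebra E A] [Module.Finite E A]
    (S : Subalgebra E (X → E)) : Subalgebra E (X → A) where
  carrier := {ξ | ∀ l : A →ₗ[E] E, (fun x => l (ξ x)) ∈ S}
  mul_mem' := by
    intro ξ ζ hξ hζ l
    let b := Module.finBasis E A
    have h : (fun x => l ((ξ * ζ) x)) =
        ∑ i, ∑ j, l (b i * b j) • ((fun x => b.coord i (ξ x)) * fun x => b.coord j (ζ x)) := by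
      funext x
      conv_lhs => rw [Pi.mul_apply, ← b.sum_repr (ξ x), ← b.sum_repr (ζ x), Finset.sum_mul_sum]
      simp only [map_sum, Finset.sum_apply, Pi.smul_apply, Pi.mul_apply, smul_eq_mul,
        Module.Basis.coord_apply, smul_mul_smul_comm, map_smul]
      exact Finset.sum_congr rfl fun i _ => Finset.sum_congr rfl fun j _ => by ring
    rw [h]
    exact S.sum_mem fun i _ => S.sum_mem fun j _ => S.smul_mem (S.mul_mem (hξ _) (hζ _)) _
  add_mem' := by
    intro ξ ζ hξ hζ l
    have := S.add_mem (hξ l) (hζ l)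
    simpa [Pi.add_def] using this
  algebraMap_mem' := by
    intro e l
    exact S.algebraMap_mem (l (algebraMap E A e))

variable [Module.Finite E A]

theorem const_mem_coordSubalgebra (S : Subalgebra E (X → E)) (a : A) :
    (fun _ => a) ∈ coordSubalgebra A S := fun l => S.algebraMap_mem (l a)

theorem smul_mem_coordSubalgebra {S : Subalgebra E (X → E)} {φ : X → E} (hφ : φ ∈ S) (a : A) :
    (fun x => φ x • a) ∈ coordSubalgebra A S := fun l => by
  have := S.smul_mem hφ (l a)
  simpa [Pi.smul_def, mul_comm] using this

theorem det_mem {R : Type*} {B : Type*} [CommRing R] [CommRing B] [Algebra R B]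
    {S : Subalgebra R (X → B)} {ι : Type*} [Fintype ι] [DecidableEq ι] {M : X → Matrix ι ι B}
    (hM : ∀ i j, (fun x => M x i j) ∈ S) : (fun x => (M x).det) ∈ S := by
  have h : (fun x => (M x).det) = ∑ σ : Equiv.Perm ι,
      ((Equiv.Perm.sign σ : ℤ) : X → B) * ∏ i, fun x => M x (σ i) i := by
    funext x
    simp [Matrix.det_apply', Finset.sum_apply, Finset.prod_apply]
  rw [h]
  exact S.sum_mem fun σ _ => S.mul_mem (S.intCast_mem _) (S.prod_mem fun i _ => hM _ _)

theorem mul_entry_mem {R : Type*} {B : Type*} [CommRing R] [CommRing B] [Algebra R B]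
    {S : Subalgebra R (X → B)} {ι κ ν : Type*} [Fintype κ]
    {M : X → Matrix ι κ B} {N : X → Matrix κ ν B}
    (hM : ∀ i j, (fun x => M x i j) ∈ S) (hN : ∀ i j, (fun x => N x i j) ∈ S) (i : ι) (j : ν) :
    (fun x => (M x * N x) i j) ∈ S := by
  have h : (fun x => (M x * N x) i j) = ∑ k, (fun x => M x i k) * fun x => N x k j := by
    funext x
    simp [Matrix.mul_apply, Finset.sum_apply]
  rw [h]
  exact S.sum_mem fun k _ => S.mul_mem (hM _ _) (hN _ _)

theorem adjugate_entry_mem {R : Type*} {B : Type*} [CommRing R] [CommRing B] [Algebra R B]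
    {S : Subalgebra R (X → B)} {ι : Type*} [Fintype ι] [DecidableEq ι] {M : X → Matrix ι ι B}
    (hM : ∀ i j, (fun x => M x i j) ∈ S) (i j : ι) : (fun x => (M x).adjugate i j) ∈ S := by
  simp only [Matrix.adjugate_apply]
  refine det_mem fun k l => ?_
  simp only [Matrix.updateRow_apply]
  split_ifs
  · by_cases hl : i = l
    · subst hl
      simp only [Pi.single_eq_same]
      exact S.one_mem
    · simp only [Pi.single_apply, Ne.symm hl, if_false]
      exact S.zero_mem
  · exact hM _ _

theorem norm_mem {S : Subalgebra E (X → E)} {ξ : X → A} (hξ : ξ ∈ coordSubalgebra A S) :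
    (fun x => Algebra.norm E (ξ x)) ∈ S := by
  classical
  simp only [Algebra.norm_eq_matrix_det (Module.finBasis E A)]
  refine det_mem fun i j => ?_
  simp only [Algebra.leftMulMatrix_eq_repr_mul]
  exact hξ ((Module.finBasis E A).coord i ∘ₗ LinearMap.mulRight E (Module.finBasis E A j))

/-- The norm is the determinant of multiplication by `a`. Being a unit of A thus becomes the
nonvanishing of one scalar function, to which the one-variable arguments apply. -/
theorem isUnit_iff_norm_ne_zero {a : A} : IsUnit a ↔ Algebra.norm E a ≠ 0 := by
  rw [← isUnit_iff_ne_zero, Algebra.norm_apply, ← LinearMap.isUnit_iff_isUnit_det]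
  constructor
  · exact fun h => h.map (Algebra.lmul E A)
  · intro h
    obtain ⟨b, hb⟩ := (Module.End.isUnit_iff _).1 h |>.2 1
    exact IsUnit.of_mul_eq_one b hb

/-- Matrix valued functions such that the entries of the matrices and of their inverses
have coordinates in `S`. -/
def EntriesIn (S : Subalgebra E (X → E)) {m : ℕ} (μ : X → GL (Fin m) A) : Prop :=
  ∀ i j, (fun x => μ x i j) ∈ coordSubalgebra A S ∧ (fun x => (μ x)⁻¹ i j) ∈ coordSubalgebra A S

theorem EntriesIn.mul {S : Subalgebra E (X → E)} {m : ℕ} {μ ν : X → GL (Fin m) A}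
    (hμ : EntriesIn S μ) (hν : EntriesIn S ν) : EntriesIn S fun x => μ x * ν x := fun i j => by
  refine ⟨mul_entry_mem (fun i j => (hμ i j).1) (fun i j => (hν i j).1) i j, ?_⟩
  simp only [_root_.mul_inv_rev]
  exact mul_entry_mem (fun i j => (hν i j).2) (fun i j => (hμ i j).2) i j

theorem EntriesIn.const (S : Subalgebra E (X → E)) {m : ℕ} (g : GL (Fin m) A) :
    EntriesIn S fun _ : X => g := fun _ _ =>
  ⟨const_mem_coordSubalgebra S _, const_mem_coordSubalgebra S _⟩

/-- Functions given by polynomials. -/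
noncomputable def polynomialFunctions (E : Type*) [Field E] : Subalgebra E (E → E) :=
  (AlgHom.pi fun x : E => Polynomial.aeval (R := E) x).range

theorem mem_polynomialFunctions {φ : E → E} :
    φ ∈ polynomialFunctions E ↔ ∃ P : E[X], ∀ x, φ x = P.eval x := by
  simp only [polynomialFunctions, AlgHom.mem_range, funext_iff, AlgHom.pi_apply, coe_aeval_eq_eval,
    eq_comm]

theorem id_mem_polynomialFunctions : (fun x : E => x) ∈ polynomialFunctions E :=
  mem_polynomialFunctions.2 ⟨Polynomial.X, by simp⟩

theorem eventually_eval_ne_zero {P : E[X]} (hP : P ≠ 0) :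
    ∀ᶠ x in cofinite, P.eval x ≠ 0 := by
  classical
  rw [eventually_cofinite]
  refine (P.roots.toFinset.finite_toSet).subset fun x hx => ?_
  simpa [hP] using hx

/-- The neighbourhoods of `0` with finite complement. -/
def cofiniteAtZero (E : Type*) [Field E] : Filter E := cofinite ⊔ pure 0

theorem eventually_cofiniteAtZero {q : E → Prop} :
    (∀ᶠ x in cofiniteAtZero E, q x) ↔ (∀ᶠ x in cofinite, q x) ∧ q 0 := by
  simp [cofiniteAtZero, eventually_sup]

theorem eventually_cofiniteAtZero_eval_ne_zero {P : E[X]} (hP : P.eval 0 ≠ 0) :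
    ∀ᶠ x in cofiniteAtZero E, P.eval x ≠ 0 :=
  eventually_cofiniteAtZero.2
    ⟨eventually_eval_ne_zero (by rintro rfl; simp at hP), hP⟩

/-- Functions that agree, near `0` and outside a finite set, with a rational function
that is regular at `0`. -/
def rationalFunctionsAtZero (E : Type*) [Field E] : Subalgebra E (E → E) where
  carrier := {φ | ∃ P Q : E[X], Q.eval 0 ≠ 0 ∧
    ∀ᶠ x in cofiniteAtZero E, Q.eval x * φ x = P.eval x}
  mul_mem' := by
    rintro φ ψ ⟨P, Q, hQ, h⟩ ⟨P', Q', hQ', h'⟩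
    refine ⟨P * P', Q * Q', by simp [hQ, hQ'], ?_⟩
    filter_upwards [h, h'] with x hx hx'
    simp only [eval_mul, Pi.mul_apply, ← hx, ← hx']
    ring
  add_mem' := by
    rintro φ ψ ⟨P, Q, hQ, h⟩ ⟨P', Q', hQ', h'⟩
    refine ⟨P * Q' + P' * Q, Q * Q', by simp [hQ, hQ'], ?_⟩
    filter_upwards [h, h'] with x hx hx'
    simp only [eval_mul, eval_add, Pi.add_apply, ← hx, ← hx']
    ring
  algebraMap_mem' := fun e => ⟨C e, 1, by simp, by simp⟩

theorem polynomialFunctions_le : polynomialFunctions E ≤ rationalFunctionsAtZero E := by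
  intro φ hφ
  obtain ⟨P, hP⟩ := mem_polynomialFunctions.1 hφ
  exact ⟨P, 1, by simp, by simp [hP]⟩

theorem coordSubalgebra_mono {S S' : Subalgebra E (X → E)} (h : S ≤ S') :
    coordSubalgebra A S ≤ coordSubalgebra A S' := fun _ hξ l => h (hξ l)

theorem rationalFunctionsAtZero_congr {φ ψ : E → E} (hφ : φ ∈ rationalFunctionsAtZero E)
    (h : ∀ᶠ x in cofiniteAtZero E, φ x = ψ x) : ψ ∈ rationalFunctionsAtZero E := by
  obtain ⟨P, Q, hQ, hP⟩ := hφ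
  refine ⟨P, Q, hQ, ?_⟩
  filter_upwards [hP, h] with x hx hx'
  rw [← hx', hx]

theorem coordSubalgebra_congr {φ ψ : E → A}
    (hφ : φ ∈ coordSubalgebra A (rationalFunctionsAtZero E))
    (h : ∀ᶠ x in cofiniteAtZero E, φ x = ψ x) :
    ψ ∈ coordSubalgebra A (rationalFunctionsAtZero E) := fun l =>
  rationalFunctionsAtZero_congr (hφ l) (h.mono fun x hx => by rw [hx])

/-- The numerator has infinitely many zeros, so it vanishes identically. All density arguments
reduce to this, with 0 as the point of interest and the dense open set met at almost all other
parameters. -/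
theorem eq_zero_of_eventually_cofinite [Infinite E] {φ : E → E}
    (hφ : φ ∈ rationalFunctionsAtZero E) (h : ∀ᶠ x in cofinite, φ x = 0) : φ 0 = 0 := by
  obtain ⟨P, Q, hQ, hP⟩ := hφ
  rw [eventually_cofiniteAtZero] at hP
  have hP0 : P = 0 := by
    by_contra h0
    obtain ⟨x, hx⟩ := ((hP.1.and h).and (eventually_eval_ne_zero h0)).exists
    exact hx.2 (by rw [← hx.1.1, hx.1.2, mul_zero])
  simpa [hP0, hQ] using hP.2

theorem inv_mem_rationalFunctionsAtZero {φ : E → E} (hφ : φ ∈ rationalFunctionsAtZero E)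
    (h0 : φ 0 ≠ 0) : (fun x => (φ x)⁻¹) ∈ rationalFunctionsAtZero E := by
  obtain ⟨P, Q, hQ, hP⟩ := hφ
  have h00 := (eventually_cofiniteAtZero.1 hP).2
  have hP0 : P.eval 0 ≠ 0 := h00 ▸ mul_ne_zero hQ h0
  refine ⟨Q, P, hP0, ?_⟩
  filter_upwards [hP, eventually_cofiniteAtZero_eval_ne_zero hP0] with x hx hx'
  have : φ x ≠ 0 := by
    rintro h
    rw [h, mul_zero] at hx
    exact hx' hx.symm
  rw [← hx, mul_assoc, mul_inv_cancel₀ this, mul_one]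

theorem eventually_ne_zero_of_mem {φ : E → E} (hφ : φ ∈ rationalFunctionsAtZero E)
    (h0 : φ 0 ≠ 0) : ∀ᶠ x in cofiniteAtZero E, φ x ≠ 0 := by
  obtain ⟨P, Q, hQ, hP⟩ := hφ
  have h00 := (eventually_cofiniteAtZero.1 hP).2
  have hP0 : P.eval 0 ≠ 0 := h00 ▸ mul_ne_zero hQ h0
  filter_upwards [hP, eventually_cofiniteAtZero_eval_ne_zero hP0] with x hx hx' h
  rw [h, mul_zero] at hx
  exact hx' hx.symm

theorem eventually_isUnit_of_mem {ξ : E → A}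
    (hξ : ξ ∈ coordSubalgebra A (rationalFunctionsAtZero E)) (h0 : IsUnit (ξ 0)) :
    ∀ᶠ x in cofiniteAtZero E, IsUnit (ξ x) := by
  simp only [isUnit_iff_norm_ne_zero (E := E)] at h0 ⊢
  exact eventually_ne_zero_of_mem (norm_mem hξ) h0

/-- Cramer's rule for the matrix of multiplication by `ξ x`: its determinant is the norm, which is
nonzero at 0 and hence invertible among the functions regular at 0. -/
theorem ringInverse_mem {ξ : E → A}
    (hξ : ξ ∈ coordSubalgebra A (rationalFunctionsAtZero E)) (h0 : IsUnit (ξ 0)) :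
    (fun x => Ring.inverse (ξ x)) ∈ coordSubalgebra A (rationalFunctionsAtZero E) := by
  classical
  let b := Module.finBasis E A
  let S := rationalFunctionsAtZero E
  let M : E → Matrix _ _ E := fun x => Algebra.leftMulMatrix b (ξ x)
  have hM : ∀ i j, (fun x => M x i j) ∈ S := fun i j => by
    simp only [M, Algebra.leftMulMatrix_eq_repr_mul]
    exact hξ (b.coord i ∘ₗ LinearMap.mulRight E (b j))
  have hdet : ∀ x, (M x).det = Algebra.norm E (ξ x) := fun x =>
    (Algebra.norm_eq_matrix_det b _).symm
  intro l
  have key : ∑ i, ∑ j, l (b i) • ((b.repr 1 j) • ((fun x => ((M x).det)⁻¹) *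
      fun x => (M x).adjugate i j)) ∈ S := by
    refine S.sum_mem fun i _ => S.sum_mem fun j _ => S.smul_mem (S.smul_mem (S.mul_mem
      (inv_mem_rationalFunctionsAtZero (det_mem hM) ?_) (adjugate_entry_mem hM _ _)) _) _
    rw [hdet]
    exact isUnit_iff_norm_ne_zero.1 h0
  refine rationalFunctionsAtZero_congr key ?_
  filter_upwards [eventually_isUnit_of_mem hξ h0] with x hx
  have h1 : (M x) *ᵥ (b.repr (Ring.inverse (ξ x))) = b.repr 1 := by
    rw [Algebra.leftMulMatrix_mulVec_repr, Ring.mul_inverse_cancel _ hx]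
  have hne : (M x).det ≠ 0 := by rw [hdet]; exact isUnit_iff_norm_ne_zero.1 hx
  have h2 : (M x).det • (b.repr (Ring.inverse (ξ x)) : _ → E) =
      (M x).adjugate *ᵥ (b.repr 1) := by
    rw [← h1, Matrix.mulVec_mulVec, Matrix.adjugate_mul, Matrix.smul_mulVec, Matrix.one_mulVec]
  have h3 : ∀ i, b.repr (Ring.inverse (ξ x)) i =
      ((M x).det)⁻¹ * ∑ j, (M x).adjugate i j * b.repr 1 j := fun i => by
    have := congrFun h2 i
    simp only [Pi.smul_apply, smul_eq_mul, Matrix.mulVec, dotProduct] at this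
    rw [← this, inv_mul_cancel_left₀ hne]
  conv_rhs => rw [← b.sum_repr (Ring.inverse (ξ x))]
  simp only [Finset.sum_apply, Pi.smul_apply, Pi.mul_apply, smul_eq_mul, map_sum, map_smul, h3,
    Finset.mul_sum, Finset.sum_mul]
  exact Finset.sum_congr rfl fun i _ => Finset.sum_congr rfl fun j _ => by ring

end FunctionAlgebras

/-! ### Pulling back regular functions along families of matrices -/

section Regular

open Polynomial Filter Matrix

/-- The algebra of functions on `GL(n+1, A) × GL(n, A)` generated by the `E`-linear coordinates
of the entries of the matrices and of their inverses. -/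
def regularAlgebra (n : ℕ) (E A : Type*) [Field E] [CommRing A] [Algebra E A] :
    Subalgebra E (GLPair n A → E) :=
  Algebra.adjoin E
    {f | ∃ l : A →ₗ[E] E,
      (∃ i j, f = fun g => l (g.1 i j)) ∨ (∃ i j, f = fun g => l (g.1⁻¹ i j)) ∨
      (∃ i j, f = fun g => l (g.2 i j)) ∨ (∃ i j, f = fun g => l (g.2⁻¹ i j))}

/-- The same statement serves two algebras S: rational functions on a line, for density, and
polynomial families with bounded denominators, for integrality. -/
theorem comp_mem_of_mem_regularAlgebra {n : ℕ} {A E X : Type*} [Field E] [CommRing A] [Algebra E A]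
    [Module.Finite E A] {S : Subalgebra E (X → E)} {μ : X → GLPair n A}
    (h₁ : EntriesIn S fun x => (μ x).1) (h₂ : EntriesIn S fun x => (μ x).2)
    {φ : GLPair n A → E} (hφ : φ ∈ regularAlgebra n E A) : (fun x => φ (μ x)) ∈ S := by
  induction hφ using Algebra.adjoin_induction with
  | mem f hf =>
    obtain ⟨l, ⟨i, j, rfl⟩ | ⟨i, j, rfl⟩ | ⟨i, j, rfl⟩ | ⟨i, j, rfl⟩⟩ := hf
    · exact (h₁ i j).1 l
    · exact (h₁ i j).2 l
    · exact (h₂ i j).1 l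
    · exact (h₂ i j).2 l
  | algebraMap e => exact S.algebraMap_mem e
  | add f g _ _ hf hg => exact S.add_mem hf hg
  | mul f g _ _ hf hg => exact S.mul_mem hf hg

end Regular

/-! ### Lines in GL(m, A) -/

section Lines

open Polynomial Filter Matrix

variable {E A : Type*} [Field E] [CommRing A] [Algebra E A] [Module.Finite E A] {m : ℕ}

theorem entriesIn_of_entries {Z : E → GL (Fin m) A}
    (hZ : ∀ i j, (fun x => Z x i j) ∈ coordSubalgebra A (rationalFunctionsAtZero E)) :
    EntriesIn (rationalFunctionsAtZero E) Z := by
  intro i j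
  refine ⟨hZ i j, ?_⟩
  have hd := ringInverse_mem (det_mem hZ) ((Matrix.isUnit_iff_isUnit_det _).1 (Z 0).isUnit)
  have := mul_mem hd (adjugate_entry_mem hZ i j)
  refine cast (congrArg (· ∈ _) ?_) this
  funext x
  rw [Matrix.coe_units_inv, Matrix.inv_def]
  rfl

/-- Two points of `GL(m)` can be joined by a line that lies in `GL(m)` generically. -/
theorem exists_line (Y Y' : GL (Fin m) A) : ∃ Z : E → GL (Fin m) A,
    EntriesIn (rationalFunctionsAtZero E) Z ∧ Z 0 = Y ∧ ∃ Z₀ : E → Matrix (Fin m) (Fin m) A,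
      (∀ i j, (fun x => Z₀ x i j) ∈ coordSubalgebra A (polynomialFunctions E)) ∧ Z₀ 1 = Y' ∧
      ∀ᶠ x in cofinite, (Z x : Matrix (Fin m) (Fin m) A) = Z₀ x := by
  classical
  let Z₀ : E → Matrix (Fin m) (Fin m) A := fun x => Y.1 + x • (Y'.1 - Y.1)
  have hZ₀ : ∀ i j, (fun x => Z₀ x i j) ∈ coordSubalgebra A (polynomialFunctions E) := fun i j =>
    add_mem (const_mem_coordSubalgebra _ _)
      (smul_mem_coordSubalgebra id_mem_polynomialFunctions _)
  have h0 : Z₀ 0 = Y.1 := by simp [Z₀]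
  have h1 : Z₀ 1 = Y'.1 := by simp [Z₀]
  have hY : IsUnit (Z₀ 0).det := h0 ▸ (Matrix.isUnit_iff_isUnit_det _).1 Y.isUnit
  have hunit : ∀ᶠ x in cofiniteAtZero E, IsUnit (Z₀ x).det :=
    eventually_isUnit_of_mem
      (det_mem fun i j => coordSubalgebra_mono polynomialFunctions_le (hZ₀ i j)) hY
  -- The value 1 at parameters where the line leaves GL(m) is arbitrary: there are only finitely
  -- many of them and 0 is not among them.
  let Z : E → GL (Fin m) A := fun x =>
    if h : IsUnit (Z₀ x).det then GeneralLinearGroup.mk'' (Z₀ x) h else 1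
  have hZ : ∀ x, IsUnit (Z₀ x).det → (Z x).1 = Z₀ x := fun x h => by
    simp only [Z, dif_pos h]
    rfl
  refine ⟨Z, entriesIn_of_entries fun i j => ?_, Units.ext ((hZ 0 hY).trans h0), Z₀, hZ₀, h1, ?_⟩
  · refine coordSubalgebra_congr (coordSubalgebra_mono polynomialFunctions_le (hZ₀ i j)) ?_
    filter_upwards [hunit] with x hx
    rw [hZ x hx]
  · filter_upwards [(eventually_cofiniteAtZero.1 hunit).1] with x hx using hZ x hx

theorem eventually_isUnit_cofinite {ξ : E → A}
    (hξ : ξ ∈ coordSubalgebra A (polynomialFunctions E)) {x₀ : E} (h : IsUnit (ξ x₀)) :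
    ∀ᶠ x in cofinite, IsUnit (ξ x) := by
  obtain ⟨P, hP⟩ := mem_polynomialFunctions.1 (norm_mem hξ)
  have hP0 : P ≠ 0 := by
    rintro rfl
    exact isUnit_iff_norm_ne_zero.1 h ((hP x₀).trans (by simp))
  filter_upwards [eventually_eval_ne_zero hP0] with x hx
  rw [isUnit_iff_norm_ne_zero (E := E), hP]
  exact hx

end Lines

/-! ### Bounded denominators and almost integrality -/

section Bounded

open Polynomial

variable (O E ι : Type*) [CommRing O] [IsDomain O] [Field E] [Algebra O E] [IsFractionRing O E]

/-- Families of functions given by polynomials with coefficients in a common fractional ideal. -/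
def boundedFunctions : Subalgebra E (ι × E → E) where
  carrier := {φ | ∃ c : O, c ≠ 0 ∧ ∀ i, ∃ P : O[X], ∀ x, algebraMap O E c * φ (i, x) = aeval x P}
  mul_mem' := by
    rintro φ ψ ⟨c, hc, h⟩ ⟨d, hd, h'⟩
    refine ⟨c * d, mul_ne_zero hc hd, fun i => ?_⟩
    obtain ⟨P, hP⟩ := h i
    obtain ⟨Q, hQ⟩ := h' i
    refine ⟨P * Q, fun x => ?_⟩
    rw [map_mul, map_mul, ← hP, ← hQ, Pi.mul_apply]
    ring
  add_mem' := by
    rintro φ ψ ⟨c, hc, h⟩ ⟨d, hd, h'⟩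
    refine ⟨c * d, mul_ne_zero hc hd, fun i => ?_⟩
    obtain ⟨P, hP⟩ := h i
    obtain ⟨Q, hQ⟩ := h' i
    refine ⟨C d * P + C c * Q, fun x => ?_⟩
    rw [map_mul, map_add, map_mul, map_mul, ← hP, ← hQ, aeval_C, aeval_C, Pi.add_apply]
    ring
  algebraMap_mem' := fun e => by
    obtain ⟨⟨a, s⟩, h⟩ := IsLocalization.surj (nonZeroDivisors O) e
    refine ⟨s, nonZeroDivisors.coe_ne_zero s, fun i => ⟨C a, fun x => ?_⟩⟩
    rw [aeval_C, ← h, mul_comm]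
    rfl

variable {O E ι}

/-- The denominator c is the same for all powers of `a`. So c T^k has coefficients in O for every k,
T is almost integral over O[X], and its coefficients are almost integral over O. For a Noetherian
integrally closed O they lie in O. -/
theorem exists_polynomial_of_pow [IsNoetherianRing O] [IsIntegrallyClosed O] [Infinite E]
    {φ : ι × E → E} (hφ : φ ∈ boundedFunctions O E ι) (i : ℕ → ι) {a : E → E}
    (h : ∀ k x, φ (i k, x) = a x ^ k) : ∃ P : O[X], ∀ x, a x = aeval x P := by
  obtain ⟨c, hc, hφ⟩ := hφ
  choose P hP using fun k => hφ (i k)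
  simp only [h] at hP
  have hc' : algebraMap O E c ≠ 0 := by simpa using hc
  let T : E[X] := C (algebraMap O E c)⁻¹ * (P 1).map (algebraMap O E)
  have hT : ∀ x, T.eval x = a x := fun x => by
    simp only [T, eval_mul, eval_C, eval_map_algebraMap, ← hP, pow_one]
    rw [inv_mul_cancel_left₀ hc']
  -- Both sides agree at every point of the infinite field E, so they agree as polynomials.
  have hpow : ∀ k, C (algebraMap O E c) * T ^ k = (P k).map (algebraMap O E) := fun k =>
    Polynomial.funext fun x => by
      simp only [eval_mul, eval_C, eval_pow, hT, hP, eval_map_algebraMap]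
  let _ := Polynomial.algebra O E
  have hint : IsAlmostIntegral O[X] T := by
    refine ⟨C c, by simpa using hc, fun k => ⟨P k, ?_⟩⟩
    rw [Algebra.smul_def]
    simp only [algebraMap_def, coe_mapRingHom, map_C]
    exact (hpow k).symm
  have hcoeff : ∀ k, ∃ o : O, algebraMap O E o = T.coeff k := fun k =>
    IsIntegrallyClosed.isIntegral_iff.1 (hint.coeff k).isIntegral
  have hlift : T ∈ Polynomial.lifts (algebraMap O E) := by
    rw [Polynomial.lifts_iff_coeff_lifts]
    exact hcoeff
  obtain ⟨Q, hQ⟩ := hlift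
  refine ⟨Q, fun x => ?_⟩
  rw [← hT, ← hQ, coe_mapRingHom, eval_map_algebraMap]

section Curves

variable {R A : Type*} [CommRing R] [CommRing A] [Algebra E A]

/-- Evaluation of polynomials over `R` at elements of `E`, along a ring homomorphism `R → A`. -/
noncomputable def evalCoeff (f : R →+* A) (x : E) : R[X] →+* A :=
  eval₂RingHom f (algebraMap E A x)

theorem evalCoeff_C (f : R →+* A) (x : E) (r : R) : evalCoeff f x (C r) = f r := by
  simp [evalCoeff]

theorem evalCoeff_X (f : R →+* A) (x : E) : evalCoeff f x X = algebraMap E A x := by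
  simp [evalCoeff]

/-- The image of `f : R → A` has bounded denominators with respect to `O`. -/
def HasDenominators (O : Type*) {E R A : Type*} [CommRing O] [Field E] [Algebra O E] [CommRing R]
    [CommRing A] [Algebra E A] (f : R →+* A) : Prop :=
  ∀ l : A →ₗ[E] E, ∃ c : O, c ≠ 0 ∧ ∀ r, ∃ o : O, algebraMap O E c * l (f r) = algebraMap O E o

variable [Module.Finite E A] {f : R →+* A} (hf : HasDenominators O (E := E) f)

include hf

/-- The denominator is that of the functional `l` on the image of R; it does not depend on the
polynomial. Hence infinite families, such as all powers of a polynomial, are allowed. -/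
theorem evalCoeff_mem (r : ι → R[X]) :
    (fun y : ι × E => evalCoeff f y.2 (r y.1)) ∈ coordSubalgebra A (boundedFunctions O E ι) := by
  intro l
  obtain ⟨c, hc, h⟩ := hf l
  choose o ho using h
  refine ⟨c, hc, fun i => ⟨∑ k ∈ Finset.range ((r i).natDegree + 1),
    C (o ((r i).coeff k)) * X ^ k, fun x => ?_⟩⟩
  simp only [evalCoeff, coe_eval₂RingHom, eval₂_eq_sum_range, map_sum, map_mul, aeval_C, map_pow,
    aeval_X, Finset.mul_sum]
  refine Finset.sum_congr rfl fun k _ => ?_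
  rw [← ho, ← map_pow, mul_comm (f _), ← Algebra.smul_def (x ^ k), map_smul, smul_eq_mul]
  ring

theorem entriesIn_evalCoeff {m : ℕ} (g : ι → GL (Fin m) R[X]) :
    EntriesIn (boundedFunctions O E ι)
      fun y : ι × E => Matrix.GeneralLinearGroup.map (evalCoeff f y.2) (g y.1) := by
  intro i j
  refine ⟨evalCoeff_mem hf fun k => (g k).1 i j, ?_⟩
  simp only [← map_inv]
  exact evalCoeff_mem hf fun k => (g k)⁻¹.1 i j

variable [IsNoetherianRing O] [IsIntegrallyClosed O] [Infinite E]

/-- A function all of whose powers are values of a fixed regular function on curves over `R`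
is a polynomial with coefficients in `O`. -/
theorem exists_polynomial_of_regular {n : ℕ} {φ : GLPair n A → E}
    (hφ : φ ∈ regularAlgebra n E A) (g : ℕ → GLPair n R[X])
    {a : E → E} (h : ∀ k x, φ (Matrix.GeneralLinearGroup.map (evalCoeff f x) (g k).1,
      Matrix.GeneralLinearGroup.map (evalCoeff f x) (g k).2) = a x ^ k) :
    ∃ P : O[X], ∀ x, a x = aeval x P :=
  exists_polynomial_of_pow (comp_mem_of_mem_regularAlgebra
    (μ := fun y : ℕ × E => (Matrix.GeneralLinearGroup.map (evalCoeff f y.2) (g y.1).1,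
      Matrix.GeneralLinearGroup.map (evalCoeff f y.2) (g y.1).2))
    (entriesIn_evalCoeff hf fun k => (g k).1) (entriesIn_evalCoeff hf fun k => (g k).2) hφ) id h

/-- The norms of the powers of `r` have a common denominator, so the norm of `r` is almost integral.
The constant polynomials `C (r ^ k)` bring this into the form of `exists_polynomial_of_pow`. -/
theorem exists_norm_eq (r : R) : ∃ o : O, Algebra.norm E (f r) = algebraMap O E o := by
  obtain ⟨P, hP⟩ := exists_polynomial_of_pow
    (norm_mem (evalCoeff_mem hf fun k : ℕ => C (r ^ k))) id
    (a := fun _ => Algebra.norm E (f r)) fun k x => by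
      simp only [id, evalCoeff_C, map_pow]
  exact ⟨P.eval 0, by rw [hP 0, ← map_zero (algebraMap O E), aeval_algebraMap_apply,
    coe_aeval_eq_eval]⟩

end Curves

end Bounded

/-! ### The valuation ring 𝒪 and denominators on 𝒪 ⊗ 𝓞 F -/

section ValuationRing

variable (p : ℕ) [Fact p.Prime] (F E : Type*) [Field F] [NumberField F] [Field E]
    [Algebra ℚ_[p] E] [FiniteDimensional ℚ_[p] E] [Algebra ℤ_[p] E] [IsScalarTower ℤ_[p] ℚ_[p] E]

theorem infinite_of_padic (p : ℕ) [Fact p.Prime] (E : Type*) [Field E] [Algebra ℚ_[p] E] :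
    Infinite E :=
  have : CharZero E := charZero_of_injective_algebraMap (algebraMap ℚ_[p] E).injective
  CharZero.infinite E

theorem isFractionRing_valuationRing : IsFractionRing (valuationRing p E) E :=
  integralClosure.isFractionRing_of_finite_extension ℚ_[p] E

theorem isNoetherianRing_valuationRing : IsNoetherianRing (valuationRing p E) :=
  have := isFractionRing_valuationRing p E
  IsIntegralClosure.isNoetherianRing ℤ_[p] ℚ_[p] E _

theorem isIntegrallyClosed_valuationRing : IsIntegrallyClosed (valuationRing p E) :=
  integralClosure.isIntegrallyClosedOfFiniteExtension ℚ_[p]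

/-- A ℤ-basis of 𝓞 F generates the image as an 𝒪-module, so a common denominator of the values of
`l` on this finite basis suffices. -/
theorem hasDenominators_integralCoeff :
    HasDenominators (valuationRing p E) (E := E) (integralCoeff p F E) := by
  intro l
  have := isFractionRing_valuationRing p E
  let b := NumberField.RingOfIntegers.basis F
  obtain ⟨s, hs⟩ := IsLocalization.exist_integer_multiples_of_finite
    (nonZeroDivisors (valuationRing p E)) fun i => l (1 ⊗ₜ b i)
  refine ⟨s, nonZeroDivisors.coe_ne_zero s, fun r => ?_⟩
  induction r using TensorProduct.induction_on with
  | zero => exact ⟨0, by simp⟩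
  | add r r' hr hr' =>
    obtain ⟨o, ho⟩ := hr
    obtain ⟨o', ho'⟩ := hr'
    exact ⟨o + o', by rw [map_add, map_add, mul_add, ho, ho']; rfl⟩
  | tmul a w =>
    choose o ho using hs
    refine ⟨∑ i, (b.repr w i) • (a * o i), ?_⟩
    have h1 : integralCoeff p F E (a ⊗ₜ w) = ∑ i, (b.repr w i) • ((a : E) • (1 ⊗ₜ[ℤ] b i)) := by
      conv_lhs => rw [← b.sum_repr w]
      simp only [TensorProduct.tmul_sum, map_sum, TensorProduct.tmul_smul, map_zsmul]
      refine Finset.sum_congr rfl fun i _ => ?_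
      congr 1
      rw [TensorProduct.smul_tmul', smul_eq_mul, mul_one]
      rfl
    rw [h1, map_sum, Finset.mul_sum]
    have h4 : ∀ (o : valuationRing p E), algebraMap (valuationRing p E) E o = o := fun _ => rfl
    rw [h4, h4, AddSubmonoidClass.coe_finsetSum]
    refine Finset.sum_congr rfl fun i _ => ?_
    have := ho i
    rw [map_zsmul, map_smul]
    have h2 : ((o i : valuationRing p E) : E) = (s : valuationRing p E) * l (1 ⊗ₜ b i) := by
      exact ho i
    have h3 : (((b.repr w i) • (a * o i) : valuationRing p E) : E) =
        (b.repr w i) • ((a : E) * (o i : E)) := rfl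
    rw [h3, h2]
    simp only [zsmul_eq_mul, smul_eq_mul]
    ring

end ValuationRing

/-! ### Minors, triangular factorization and divisibility of determinants -/

section Minors

open Matrix

variable {R : Type*} [CommRing R]

section Blocks

variable {n : ℕ} (a : Matrix (Fin n) (Fin n) R) (b : Matrix (Fin n) (Fin 1) R)
  (c : Matrix (Fin 1) (Fin n) R) (d : Matrix (Fin 1) (Fin 1) R)

@[simp]
theorem blocks_castSucc_castSucc (i j : Fin n) : blocks a b c d i.castSucc j.castSucc = a i j := by
  have h : ∀ i : Fin n, finSumFinEquiv.symm i.castSucc = Sum.inl (β := Fin 1) i := fun i => by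
    rw [Equiv.symm_apply_eq]; rfl
  simp [blocks, h]

@[simp]
theorem blocks_castSucc_last (i : Fin n) : blocks a b c d i.castSucc (Fin.last n) = b i 0 := by
  have h : ∀ i : Fin n, finSumFinEquiv.symm i.castSucc = Sum.inl (β := Fin 1) i := fun i => by
    rw [Equiv.symm_apply_eq]; rfl
  have h' : finSumFinEquiv.symm (Fin.last n) = Sum.inr (α := Fin n) (0 : Fin 1) := by
    rw [Equiv.symm_apply_eq]; rfl
  simp [blocks, h, h']

@[simp]
theorem blocks_last_castSucc (j : Fin n) : blocks a b c d (Fin.last n) j.castSucc = c 0 j := by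
  have h : ∀ i : Fin n, finSumFinEquiv.symm i.castSucc = Sum.inl (β := Fin 1) i := fun i => by
    rw [Equiv.symm_apply_eq]; rfl
  have h' : finSumFinEquiv.symm (Fin.last n) = Sum.inr (α := Fin n) (0 : Fin 1) := by
    rw [Equiv.symm_apply_eq]; rfl
  simp [blocks, h, h']

@[simp]
theorem blocks_last_last : blocks a b c d (Fin.last n) (Fin.last n) = d 0 0 := by
  have h' : finSumFinEquiv.symm (Fin.last n) = Sum.inr (α := Fin n) (0 : Fin 1) := by
    rw [Equiv.symm_apply_eq]; rfl
  simp [blocks, h']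

theorem blocks_ext {M : Matrix (Fin (n + 1)) (Fin (n + 1)) R}
    (ha : ∀ i j, M i.castSucc j.castSucc = a i j) (hb : ∀ i, M i.castSucc (Fin.last n) = b i 0)
    (hc : ∀ j, M (Fin.last n) j.castSucc = c 0 j) (hd : M (Fin.last n) (Fin.last n) = d 0 0) :
    M = blocks a b c d := by
  ext i j
  refine Fin.lastCases ?_ (fun i => ?_) i <;> refine Fin.lastCases ?_ (fun j => ?_) j
  · rw [hd, blocks_last_last]
  · rw [hc, blocks_last_castSucc]
  · rw [hb, blocks_castSucc_last]
  · rw [ha, blocks_castSucc_castSucc]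

end Blocks

theorem diagHom_val {m : ℕ} (t : Fin m → Rˣ) :
    (diagHom t : Matrix (Fin m) (Fin m) R) = diagonal fun i => (t i : R) := rfl

variable {m : ℕ}

/-- The indices `0, …, k - 1, r`. -/
def rowIndices (k r : Fin m) : Fin ((k : ℕ) + 1) → Fin m :=
  Fin.snoc (α := fun _ => Fin m) (fun i : Fin k => Fin.castLE k.2.le i) r

/-- The indices `0, …, k`. -/
def firstIndices (k : Fin m) : Fin ((k : ℕ) + 1) → Fin m :=
  Fin.castLE (Nat.succ_le_of_lt k.2)

@[simp]
theorem rowIndices_castSucc (k r : Fin m) (i : Fin k) :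
    rowIndices k r i.castSucc = Fin.castLE k.2.le i := by simp [rowIndices]

@[simp]
theorem rowIndices_last (k r : Fin m) : rowIndices k r (Fin.last _) = r := by simp [rowIndices]

@[simp]
theorem firstIndices_castSucc (k : Fin m) (i : Fin k) :
    firstIndices k i.castSucc = Fin.castLE k.2.le i := rfl

@[simp]
theorem firstIndices_last (k : Fin m) : firstIndices k (Fin.last _) = k := rfl

theorem firstIndices_injective (k : Fin m) : Function.Injective (firstIndices k) :=
  Fin.castLE_injective _

theorem val_firstIndices (k : Fin m) (i : Fin ((k : ℕ) + 1)) : (firstIndices k i : ℕ) = i := rfl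

theorem rowIndices_self (k : Fin m) : rowIndices k k = firstIndices k := by
  funext i
  refine Fin.lastCases ?_ (fun i => ?_) i <;> simp

/-- The minor of `Y` with rows `0, …, k - 1, r` and columns `0, …, k`. -/
def minor (Y : Matrix (Fin m) (Fin m) R) (k r : Fin m) : R :=
  (Y.submatrix (rowIndices k r) (firstIndices k)).det

theorem minor_map {S : Type*} [CommRing S] (f : R →+* S) (Y : Matrix (Fin m) (Fin m) R)
    (k r : Fin m) : minor (Y.map f) k r = f (minor Y k r) := by
  rw [minor, minor, RingHom.map_det]
  rfl

/-- The first k + 1 columns of Y * U only involve the first k + 1 columns of Y and the corner of U,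
which is triangular. -/
theorem minor_mul_upper (Y U : Matrix (Fin m) (Fin m) R) (hU : ∀ i j, j < i → U i j = 0)
    (k r : Fin m) :
    minor (Y * U) k r = minor Y k r * ∏ i, U (firstIndices k i) (firstIndices k i) := by
  have h : (Y * U).submatrix (rowIndices k r) (firstIndices k) =
      Y.submatrix (rowIndices k r) (firstIndices k) *
        U.submatrix (firstIndices k) (firstIndices k) := by
    ext i j
    simp only [submatrix_apply, mul_apply]
    symm
    refine Fintype.sum_of_injective (firstIndices k) (firstIndices_injective k) _ _ ?_
      fun _ => rfl
    intro l hl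
    rw [hU, mul_zero]
    by_contra hlt
    rw [not_lt] at hlt
    refine hl ⟨⟨l, lt_of_le_of_lt (Fin.le_def.1 hlt) ?_⟩, rfl⟩
    rw [val_firstIndices]
    exact j.2
  rw [minor, h, det_mul, minor]
  congr 1
  refine det_of_isUpperTriangular fun i j hij => hU _ _ ?_
  exact hij

/-- The selected rows and columns form a triangular block whose diagonal is 1, …, 1, L r k, even
when r is not k. -/
theorem minor_of_lower (L : Matrix (Fin m) (Fin m) R)
    (hL : ∀ i j, (i = j → L i j = 1) ∧ (i < j → L i j = 0)) (k r : Fin m) :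
    minor L k r = L r k := by
  rw [minor, det_of_isLowerTriangular, Fin.prod_univ_castSucc]
  · simp only [submatrix_apply, rowIndices_castSucc, firstIndices_castSucc, rowIndices_last,
      firstIndices_last, (hL _ _).1 rfl, Finset.prod_const_one, one_mul]
  · intro i j hij
    have hij' : i < j := hij
    rw [submatrix_apply]
    induction i using Fin.lastCases with
    | last => exact absurd hij' (not_lt.2 (Fin.le_last j))
    | cast i =>
      rw [rowIndices_castSucc]
      refine (hL _ _).2 ?_
      exact hij'

theorem minor_diagonal_mul (t : Fin m → R) (Y : Matrix (Fin m) (Fin m) R) (k r : Fin m) :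
    minor (diagonal t * Y) k r = (∏ i : Fin k, t (Fin.castLE k.2.le i)) * t r * minor Y k r := by
  have h : (diagonal t * Y).submatrix (rowIndices k r) (firstIndices k) =
      diagonal (t ∘ rowIndices k r) * Y.submatrix (rowIndices k r) (firstIndices k) := by
    ext i j
    simp [diagonal_mul]
  rw [minor, h, det_mul, det_diagonal, Fin.prod_univ_castSucc, minor]
  simp

theorem minor_mul_diagonal (t : Fin m → R) (Y : Matrix (Fin m) (Fin m) R) (k r : Fin m) :
    minor (Y * diagonal t) k r = minor Y k r * ∏ i, t (firstIndices k i) := by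
  rw [minor_mul_upper _ _ fun i j hij => diagonal_apply_ne _ hij.ne']
  simp

theorem minor_last_last {n : ℕ} (Y : Matrix (Fin (n + 1)) (Fin (n + 1)) R) :
    minor Y (Fin.last n) (Fin.last n) = Y.det := by
  rw [minor, rowIndices_self]
  rfl

theorem minor_submatrix_castSucc {n : ℕ} (Y : Matrix (Fin (n + 1)) (Fin (n + 1)) R) (k : Fin n) :
    minor (Y.submatrix Fin.castSucc Fin.castSucc) k k = minor Y k.castSucc k.castSucc := by
  rw [minor, minor, rowIndices_self, rowIndices_self]
  rfl

/-- A matrix with invertible leading principal minors is the product of a lower unipotent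
and an upper triangular matrix. -/
theorem exists_lower_mul_upper : ∀ {m : ℕ} (Y : Matrix (Fin m) (Fin m) R),
    (∀ k, IsUnit (minor Y k k)) → ∃ L U : Matrix (Fin m) (Fin m) R,
      (∀ i j, (i = j → L i j = 1) ∧ (i < j → L i j = 0)) ∧ (∀ i j, j < i → U i j = 0) ∧
      Y = L * U
  | 0, Y, _ => ⟨1, 1, fun i => i.elim0, fun i => i.elim0, by ext i; exact i.elim0⟩
  | m + 1, Y, h => by
    obtain ⟨L, U, hL, hU, hY⟩ := exists_lower_mul_upper (Y.submatrix Fin.castSucc Fin.castSucc)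
      fun k => by rw [minor_submatrix_castSucc]; exact h _
    have hLdet : IsUnit L.det := by
      rw [det_of_isLowerTriangular L fun i j hij => (hL i j).2 hij]
      simp [(hL _ _).1 rfl]
    have hUdet : IsUnit U.det := by
      rw [det_of_isUpperTriangular fun i j hij => hU i j hij]
      rw [IsUnit.prod_univ_iff]
      intro k
      have hk := h k.castSucc
      rw [← minor_submatrix_castSucc, hY, minor_mul_upper _ _ hU, Fin.prod_univ_castSucc] at hk
      exact isUnit_of_mul_isUnit_right (isUnit_of_mul_isUnit_right hk)
    let b : Matrix (Fin m) (Fin 1) R := of fun i _ => Y i.castSucc (Fin.last m)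
    let c : Matrix (Fin 1) (Fin m) R := of fun _ j => Y (Fin.last m) j.castSucc
    let d : Matrix (Fin 1) (Fin 1) R := of fun _ _ => Y (Fin.last m) (Fin.last m)
    -- Block elimination: the last diagonal entry of the upper factor is the Schur complement. It
    -- need not be a unit for the factorization itself.
    refine ⟨blocks L 0 (c * U⁻¹) 1, blocks U (L⁻¹ * b) 0 (d - c * U⁻¹ * (L⁻¹ * b)), ?_, ?_, ?_⟩
    · intro i j
      refine Fin.lastCases ?_ (fun i => ?_) i <;> refine Fin.lastCases ?_ (fun j => ?_) j
      · simp
      · exact ⟨fun h => absurd h.symm (Fin.castSucc_ne_last j),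
          fun h => absurd h (not_lt.2 (Fin.le_last _))⟩
      · simp
      · simpa using hL i j
    · intro i j
      refine Fin.lastCases ?_ (fun i => ?_) i <;> refine Fin.lastCases ?_ (fun j => ?_) j
      · simp
      · simp
      · intro h
        exact absurd h (not_lt.2 (Fin.le_last _))
      · simpa using hU i j
    · rw [blocks_mul]
      have hb : L * (L⁻¹ * b) = b := by
        rw [← Matrix.mul_assoc, mul_nonsing_inv _ hLdet, Matrix.one_mul]
      have hc : c * U⁻¹ * U = c := by
        rw [Matrix.mul_assoc, nonsing_inv_mul _ hUdet, Matrix.mul_one]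
      refine blocks_ext _ _ _ _ (fun i j => ?_) (fun i => ?_) (fun j => ?_) ?_
      · simp [← hY]
      · simp [hb, b]
      · simp [hc, c]
      · simp [d]

/-- Divisibility of `det (A * diagonal (X ^ ω) * C)` by a power of `X`. -/
theorem pow_mul_dvd_det {κ ν : Type*} [Fintype κ] [DecidableEq κ] [Fintype ν] [DecidableEq ν]
    (x s : R) (N : ℕ) (ω : ν → ℕ) (A : Matrix κ ν R) (C : Matrix ν κ R)
    (hω : ∀ φ : κ → ν, Function.Injective φ → (∀ i, A i (φ i) ≠ 0) → N ≤ ∑ i, ω (φ i))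
    (hC : ∀ φ : κ → ν, s ∣ (C.submatrix φ id).det) :
    x ^ N * s ∣ (A * diagonal (fun j => x ^ ω j) * C).det := by
  -- Expansion by multilinearity in the rows, a Cauchy–Binet formula summed over all maps φ.
  -- Noninjective φ contribute zero because two rows coincide.
  have h : (A * diagonal (fun j => x ^ ω j) * C).det =
      ∑ φ : κ → ν, (∏ i, A i (φ i) * x ^ ω (φ i)) * (C.submatrix φ id).det := by
    have h1 : A * diagonal (fun j => x ^ ω j) * C =
        fun i => ∑ j, (A i j * x ^ ω j) • C j := by
      ext i k
      rw [mul_apply, Finset.sum_apply]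
      simp only [mul_diagonal, Pi.smul_apply, smul_eq_mul]
    rw [h1]
    have h2 := (detRowAlternating (R := R) (n := κ)).toMultilinearMap.map_sum
      (g := fun i j => (A i j * x ^ ω j) • C j)
    refine Eq.trans h2 (Finset.sum_congr rfl fun φ _ => ?_)
    exact (detRowAlternating (R := R) (n := κ)).toMultilinearMap.map_smul_univ _ _
  rw [h]
  refine Finset.dvd_sum fun φ _ => ?_
  by_cases hinj : Function.Injective φ
  · by_cases hne : ∀ i, A i (φ i) ≠ 0
    · rw [Finset.prod_mul_distrib, Finset.prod_pow_eq_pow_sum, mul_assoc]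
      exact Dvd.dvd.mul_left (mul_dvd_mul (pow_dvd_pow x (hω φ hinj hne)) (hC φ)) _
    · push Not at hne
      obtain ⟨i, hi⟩ := hne
      rw [Finset.prod_eq_zero (Finset.mem_univ i) (by rw [hi, zero_mul]), zero_mul]
      exact dvd_zero _
  · simp only [Function.Injective] at hinj
    push Not at hinj
    obtain ⟨i, j, hij, hne⟩ := hinj
    rw [det_zero_of_row_eq hne (by funext k; simp [hij]), mul_zero]
    exact dvd_zero _

theorem sum_le_sum_of_injective {k : ℕ} (ω : Fin k → ℕ) (hω : Function.Injective ω) :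
    ∑ i : Fin k, (i : ℕ) ≤ ∑ i, ω i := by
  induction k with
  | zero => simp
  | succ k ih =>
    -- By the pigeonhole principle, k + 1 distinct naturals cannot all be below k. Removing one that
    -- is at least k leaves the induction hypothesis.
    obtain ⟨i, hi⟩ : ∃ i, k ≤ ω i := by
      by_contra! h
      have := Fintype.card_le_of_injective (fun i => (⟨ω i, h i⟩ : Fin k))
        fun i j hij => hω (congrArg Fin.val hij)
      simp at this
    rw [Fin.sum_univ_castSucc, Fin.sum_univ_succAbove ω i, add_comm]
    exact add_le_add hi (ih _ (hω.comp Fin.succAbove_right_injective))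

end Minors

/-! ### The open orbit and a section of the map to the minors -/

section Sections

open Matrix

variable {R : Type*} [CommRing R] {n : ℕ}

/-- The unipotent matrix with last row `(x, 1)`. -/
def rowGL (x : Fin n → R) : GL (Fin (n + 1)) R where
  val := blocks 1 0 (of fun _ => x) 1
  inv := blocks 1 0 (-of fun _ => x) 1
  val_inv := by simp [blocks_mul, blocks_one]
  inv_val := by simp [blocks_mul, blocks_one]

/-- The unipotent matrix with last column `(x, 1)`. -/
def colGL (x : Fin n → R) : GL (Fin (n + 1)) R where
  val := blocks 1 (of fun i _ => x i) 0 1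
  inv := blocks 1 (-of fun i _ => x i) 0 1
  val_inv := by simp [blocks_mul, blocks_one]
  inv_val := by simp [blocks_mul, blocks_one]

/-- The matrix with rows `-e₁, …, -eₙ, e₀`. -/
def cycleGL (n : ℕ) (R : Type*) [CommRing R] : GL (Fin (n + 1)) R where
  val := of fun i j => Fin.lastCases (motive := fun _ => R) (if j = 0 then 1 else 0)
    (fun i' => if j = i'.succ then -1 else 0) i
  inv := of fun i j => Fin.cases (motive := fun _ => R) (if j = Fin.last n then 1 else 0)
    (fun i' => if j = i'.castSucc then -1 else 0) i
  val_inv := by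
    ext i j
    rw [mul_apply]
    refine Fin.lastCases ?_ (fun i => ?_) i
    · simp [one_apply, eq_comm]
    · simp only [of_apply, Fin.lastCases_castSucc, ite_mul, zero_mul, Finset.sum_ite_eq',
        Finset.mem_univ, if_true, Fin.cases_succ, one_apply, eq_comm (a := j)]
      split_ifs <;> simp
  inv_val := by
    ext i j
    rw [mul_apply]
    refine Fin.cases ?_ (fun i => ?_) i
    · simp [one_apply, eq_comm]
    · simp only [of_apply, Fin.cases_succ, ite_mul, zero_mul, Finset.sum_ite_eq',
        Finset.mem_univ, if_true, Fin.lastCases_castSucc, one_apply, eq_comm (a := j)]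
      split_ifs <;> simp

/-- The matrix with first column `(d, 1)` and remaining columns `-e₀, …, -eₙ₋₁`. -/
def sectionGL (d : Fin n → R) : GL (Fin (n + 1)) R := colGL d * cycleGL n R

theorem sectionGL_zero (d : Fin n → R) (r : Fin (n + 1)) :
    sectionGL d r 0 = Fin.snoc (α := fun _ => R) d 1 r := by
  change ((blocks 1 (of fun i _ => d i) 0 1 : Matrix (Fin (n + 1)) (Fin (n + 1)) R) *
    (cycleGL n R).1) r 0 = _
  rw [mul_apply, Fin.sum_univ_castSucc]
  refine Fin.lastCases ?_ (fun r => ?_) r <;> simp [cycleGL, Fin.succ_ne_zero, eq_comm]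

theorem sectionGL_succ (d : Fin n → R) (r : Fin (n + 1)) (j : Fin n) :
    sectionGL d r j.succ = if r = j.castSucc then -1 else 0 := by
  change ((blocks 1 (of fun i _ => d i) 0 1 : Matrix (Fin (n + 1)) (Fin (n + 1)) R) *
    (cycleGL n R).1) r j.succ = _
  rw [mul_apply, Fin.sum_univ_castSucc]
  refine Fin.lastCases ?_ (fun r => ?_) r
  · simp [cycleGL, Fin.succ_ne_zero, (Fin.castSucc_ne_last _).symm]
  · simp [cycleGL, one_apply, Fin.succ_ne_zero]
    split_ifs <;> simp

/-- This prescribes the leading minors as an arbitrary tuple `d`, not only of units, while the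
minors involving the last row and the determinant stay 1. The signs of the columns are chosen to
absorb the sign of the Laplace expansion. -/
theorem minor_sectionGL (d : Fin n → R) {k r : Fin (n + 1)} (h : k ≤ r) :
    minor (sectionGL d).1 k r = Fin.snoc (α := fun _ => R) d 1 r := by
  have hsucc : ∀ j : Fin k, firstIndices k j.succ =
      Fin.succ (⟨j, lt_of_lt_of_le j.2 (Nat.lt_succ_iff.1 k.2)⟩ : Fin n) := fun j => rfl
  have hcast : ∀ j : Fin k, Fin.castLE k.2.le j =
      Fin.castSucc (⟨j, lt_of_lt_of_le j.2 (Nat.lt_succ_iff.1 k.2)⟩ : Fin n) := fun j => rfl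
  have hzero : firstIndices k 0 = 0 := rfl
  rw [minor, det_succ_row _ (Fin.last _), Fin.sum_univ_succ]
  have h0 : ∀ j : Fin k, ((sectionGL d).1.submatrix (rowIndices k r) (firstIndices k))
      (Fin.last _) j.succ = 0 := fun j => by
    rw [submatrix_apply, rowIndices_last, hsucc, sectionGL_succ, if_neg]
    rintro rfl
    exact absurd (Fin.le_def.1 h) (not_le.2 j.2)
  have h1 : (((sectionGL d).1.submatrix (rowIndices k r) (firstIndices k)).submatrix
      (Fin.last (k : ℕ)).succAbove (Fin.succAbove 0)) = diagonal fun _ => (-1 : R) := by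
    ext i j
    rw [submatrix_apply, submatrix_apply, Fin.succAbove_last, rowIndices_castSucc,
      Fin.succAbove_zero, hsucc, sectionGL_succ, hcast, diagonal_apply]
    simp [Fin.ext_iff]
  rw [h1]
  simp only [h0, mul_zero, zero_mul, Finset.sum_const_zero, add_zero, det_diagonal,
    Finset.prod_const, Finset.card_univ, Fintype.card_fin, Fin.val_last, Fin.val_zero,
    submatrix_apply, rowIndices_last, hzero, sectionGL_zero]
  rw [mul_right_comm, ← pow_add, Even.neg_one_pow ⟨_, rfl⟩, one_mul]

theorem rowGL_lower (x : Fin n → R) : IsLowerUnipotent (rowGL x) := by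
  intro i j
  have h : (rowGL x).1 = blocks 1 0 (of fun _ => x) 1 := rfl
  rw [h]
  refine Fin.lastCases ?_ (fun i => ?_) i <;> refine Fin.lastCases ?_ (fun j => ?_) j
  · simp
  · exact ⟨fun h => absurd h.symm (Fin.castSucc_ne_last j),
      fun h => absurd h (not_lt.2 (Fin.le_last _))⟩
  · simp
  · simp only [blocks_castSucc_castSucc, one_apply, Fin.castSucc_inj, Fin.castSucc_lt_castSucc_iff]
    exact ⟨fun h => if_pos h, fun h => if_neg h.ne⟩

theorem minor_rowGL (x : Fin n → R) (k r : Fin (n + 1)) : minor (rowGL x).1 k r = rowGL x r k :=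
  minor_of_lower _ (rowGL_lower x) k r

theorem snoc_mul_snoc {M : Type*} [Mul M] (a b : Fin n → M) (c d : M) :
    Fin.snoc (α := fun _ => M) (a * b) (c * d) =
      Fin.snoc (α := fun _ => M) a c * Fin.snoc (α := fun _ => M) b d := by
  funext i
  refine Fin.lastCases ?_ (fun i => ?_) i <;> simp

theorem cons_mul_cons {M : Type*} [Mul M] (a b : Fin n → M) (c d : M) :
    Fin.cons (α := fun _ => M) (c * d) (a * b) =
      Fin.cons (α := fun _ => M) c a * Fin.cons (α := fun _ => M) d b := by
  funext i
  refine Fin.cases ?_ (fun i => ?_) i <;> simp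

/-- The torus element that moves the base point to a point with prescribed minors. -/
def cellTorus : (Fin n → Rˣ) × (Fin n → Rˣ) × Rˣ →* (Fin n → Rˣ) × (Fin (n + 1) → Rˣ) where
  -- Here t = (d, x, δ). The diagonal part of the triangular factorization has the successive
  -- quotients of d₀, …, dₙ₋₁, δ as entries, and x / d rescales the last row of the lower factor.
  toFun t := (t.1 / t.2.1, Fin.snoc (α := fun _ => Rˣ) (t.2.1 / t.1) 1 *
    (Fin.snoc (α := fun _ => Rˣ) t.1 t.2.2 / Fin.cons (α := fun _ => Rˣ) 1 t.1))
  map_one' := by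
    refine Prod.ext (by simp) (funext fun i => ?_)
    have h1 : Fin.snoc (α := fun _ => Rˣ) (1 : Fin n → Rˣ) 1 = 1 := by
      funext i
      refine Fin.lastCases ?_ (fun i => ?_) i <;> simp
    have h2 : Fin.cons (α := fun _ => Rˣ) 1 (1 : Fin n → Rˣ) = 1 := by
      funext i
      refine Fin.cases ?_ (fun i => ?_) i <;> simp
    simp [h1, h2]
  map_mul' s t := by
    refine Prod.ext (mul_div_mul_comm _ _ _ _) ?_
    simp only [Prod.fst_mul, Prod.snd_mul]
    have h1 := snoc_mul_snoc (s.2.1 / s.1) (t.2.1 / t.1) 1 1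
    have h2 := cons_mul_cons s.1 t.1 1 1
    rw [mul_one] at h1 h2
    rw [mul_div_mul_comm, h1, h2, snoc_mul_snoc, mul_div_mul_comm, mul_mul_mul_comm]

/-- A function on `GL(n+1, R)` that is semi-invariant under the lower triangular subgroup of
`GL(n, R)` on the left and the upper triangular subgroup on the right. -/
structure IsSemiInvariant {E : Type*} [Field E] (Φ : GL (Fin (n + 1)) R → E)
    (ψ : (Fin n → Rˣ) × (Fin (n + 1) → Rˣ) →* Eˣ) : Prop where
  lower : ∀ c Y, IsLowerUnipotent c → Φ (jHom c * Y) = Φ Y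
  upper : ∀ b Y, IsUpperUnipotent b → Φ (Y * b) = Φ Y
  torus : ∀ t Y, Φ (jHom (diagHom t.1) * Y * diagHom t.2) = ψ t * Φ Y

theorem exists_lower_mul_diagonal_mul_upper {m : ℕ} (Y : GL (Fin m) R)
    (h : ∀ k, IsUnit (minor Y.1 k k)) : ∃ (L : GL (Fin m) R) (t : Fin m → Rˣ) (U : GL (Fin m) R),
      IsLowerUnipotent L ∧ IsUpperUnipotent U ∧ Y = L * diagHom t * U ∧
      ∀ k r, minor Y.1 k r = L r k * ∏ i, (t (firstIndices k i) : R) := by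
  obtain ⟨L, U, hL, hU, hY⟩ := exists_lower_mul_upper Y.1 h
  have hminor : ∀ k r, minor Y.1 k r = L r k * ∏ i, U (firstIndices k i) (firstIndices k i) :=
    fun k r => by rw [hY, minor_mul_upper _ _ hU, minor_of_lower _ hL]
  have hLdet : L.det = 1 := by
    rw [det_of_isLowerTriangular L fun i j hij => (hL i j).2 hij]
    simp [(hL _ _).1 rfl]
  have hunit : ∀ k, IsUnit (U k k) := fun k => by
    have hk := h k
    rw [hminor, Fin.prod_univ_castSucc] at hk
    exact isUnit_of_mul_isUnit_right (isUnit_of_mul_isUnit_right hk)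
  choose t ht using hunit
  let L' : GL (Fin m) R := GeneralLinearGroup.mk'' L (hLdet ▸ isUnit_one)
  refine ⟨L', t, (diagHom t)⁻¹ * L'⁻¹ * Y, hL, ?_, by group, fun k r => ?_⟩
  · have hU' : ((diagHom t)⁻¹ * L'⁻¹ * Y).1 = diagonal (fun i => (↑(t i)⁻¹ : R)) * U := by
      have h1 : L' * GeneralLinearGroup.mk'' U (by
          rw [det_of_isUpperTriangular fun i j hij => hU i j hij, IsUnit.prod_univ_iff]
          exact fun k => ht k ▸ (t k).isUnit) = Y := Units.ext hY.symm
      rw [← h1, mul_assoc, inv_mul_cancel_left, ← map_inv]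
      rfl
    intro i j
    rw [hU', diagonal_mul]
    refine ⟨?_, fun hij => by rw [hU i j hij, mul_zero]⟩
    rintro rfl
    rw [← ht, Units.inv_mul]
  · rw [hminor]
    simp only [ht]
    rfl

theorem prod_firstIndices_castSucc {M : Type*} [CommMonoid M] (t : Fin (n + 1) → M) (k : Fin n) :
    ∏ i, t (firstIndices k.succ i) = (∏ i, t (firstIndices k.castSucc i)) * t k.succ := by
  exact Fin.prod_univ_castSucc _

namespace IsSemiInvariant

variable {E : Type*} [Field E] {Φ : GL (Fin (n + 1)) R → E}
  {ψ : (Fin n → Rˣ) × (Fin (n + 1) → Rˣ) →* Eˣ}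

/-- Triangular factorization puts Y into the orbit of `rowGL 1`. The upper factor is absorbed on the
right and the corner of the lower factor on the left; what remains is the last row w = x / d, which
the torus carries to (1, …, 1). -/
theorem eq_of_isUnit_minors (hΦ : IsSemiInvariant Φ ψ) (Y : GL (Fin (n + 1)) R)
    {d x : Fin n → Rˣ} {δ : Rˣ} (hd : ∀ k, minor Y.1 k.castSucc k.castSucc = d k)
    (hx : ∀ k, minor Y.1 k.castSucc (Fin.last n) = x k) (hδ : Y.1.det = δ) :
    Φ Y = ψ (cellTorus (d, x, δ)) * Φ (rowGL 1) := by
  have hmin : ∀ k, minor Y.1 k k = Fin.snoc (α := fun _ => Rˣ) d δ k := fun k => by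
    refine Fin.lastCases ?_ (fun k => ?_) k
    · rw [minor_last_last, hδ, Fin.snoc_last]
    · rw [hd, Fin.snoc_castSucc]
  obtain ⟨L, t, U, hL, hU, hY, hLt⟩ := exists_lower_mul_diagonal_mul_upper Y fun k => by
    rw [hmin]; exact Units.isUnit _
  have hprod : ∀ k, ∏ i, t (firstIndices k i) = Fin.snoc (α := fun _ => Rˣ) d δ k := fun k => by
    have := hmin k
    rw [hLt, (hL _ _).1 rfl, one_mul] at this
    exact Units.ext (by rw [← this, Units.coe_prod])
  have ht : t = Fin.snoc (α := fun _ => Rˣ) d δ / Fin.cons (α := fun _ => Rˣ) 1 d := by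
    funext k
    rw [Pi.div_apply, ← hprod k]
    refine Fin.cases ?_ (fun k => ?_) k
    · rw [Fin.cons_zero, div_one]
      exact (Fin.prod_univ_one fun i => t (firstIndices 0 i)).symm
    · rw [prod_firstIndices_castSucc, hprod, Fin.cons_succ, Fin.snoc_castSucc,
        mul_div_cancel_left]
  let w : Fin n → Rˣ := x / d
  have hw : ∀ k : Fin n, L (Fin.last n) k.castSucc = w k := fun k => by
    have h1 := hLt k.castSucc (Fin.last n)
    rw [← Units.coe_prod, hprod, hx, Fin.snoc_castSucc] at h1
    change _ = ((x k / d k : Rˣ) : R)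
    rw [div_eq_mul_inv, Units.val_mul, h1, Units.mul_inv_cancel_right]
  let L₀ : Matrix (Fin n) (Fin n) R := L.1.submatrix Fin.castSucc Fin.castSucc
  have hL₀ : ∀ i j, (i = j → L₀ i j = 1) ∧ (i < j → L₀ i j = 0) := fun i j =>
    ⟨fun h => (hL _ _).1 (h ▸ rfl), fun h => (hL _ _).2 h⟩
  let L₁ : GL (Fin n) R := GeneralLinearGroup.mk'' L₀ (by
    rw [det_of_isLowerTriangular L₀ fun i j hij => (hL₀ i j).2 hij]
    simp [(hL₀ _ _).1 rfl])
  have hfac : L = jHom L₁ * rowGL fun k => (w k : R) := by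
    refine Units.ext ?_
    change L.1 = blocks L₀ 0 0 1 * blocks 1 0 (of fun _ k => (w k : R)) 1
    rw [blocks_mul]
    refine blocks_ext _ _ _ _ (fun i j => ?_) (fun i => ?_) (fun j => ?_) ?_
    · simp [L₀]
    · simpa using (hL i.castSucc (Fin.last n)).2 (Fin.castSucc_lt_last i)
    · simpa using hw j
    · simpa using (hL (Fin.last n) (Fin.last n)).1 rfl
  -- This is where the left torus of GL(n) is needed: conjugation by it turns unit entries of the
  -- last row into ones.
  have hrow : (rowGL fun k => (w k : R)) =
      jHom (diagHom w⁻¹) * rowGL 1 * diagHom (Fin.snoc (α := fun _ => Rˣ) w 1) := by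
    refine Units.ext ?_
    change blocks 1 0 (of fun _ k => (w k : R)) 1 =
      blocks (diagonal fun i => ((w⁻¹) i : R)) 0 0 1 * blocks 1 0 (of fun _ => 1) 1 *
        diagonal fun i => ((Fin.snoc (α := fun _ => Rˣ) w 1 : Fin (n + 1) → Rˣ) i : R)
    symm
    rw [blocks_mul]
    refine blocks_ext _ _ _ _ (fun i j => ?_) (fun i => ?_) (fun j => ?_) ?_
    · rw [mul_diagonal]
      by_cases hij : i = j
      · subst hij
        simp
      · simp [hij]
    · simp [mul_diagonal]
    · simp [mul_diagonal]
    · simp [mul_diagonal]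
  have hYfac : Y = jHom L₁ * (jHom (diagHom w⁻¹) * rowGL 1 *
      diagHom (Fin.snoc (α := fun _ => Rˣ) w 1 * t)) * U := by
    rw [hY, hfac, hrow, map_mul]
    simp only [mul_assoc]
  have hcell : cellTorus (d, x, δ) = (w⁻¹, Fin.snoc (α := fun _ => Rˣ) w 1 * t) := by
    refine Prod.ext ?_ ?_
    · simp [cellTorus, w]
    · rw [ht]
      rfl
  rw [hYfac, hΦ.upper _ _ hU, hΦ.lower L₁ _ hL₀, hcell]
  exact hΦ.torus (_, _) _

end IsSemiInvariant

end Sections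

/-! ### Density of the open orbit and multiplicativity -/

section Density

open Matrix Filter

variable {E A : Type*} [Field E] [CommRing A] [Algebra E A] [Module.Finite E A]

theorem minor_mem {X : Type*} {S : Subalgebra E (X → A)} {m : ℕ}
    {M : X → Matrix (Fin m) (Fin m) A} (hM : ∀ i j, (fun x => M x i j) ∈ S) (k r : Fin m) :
    (fun x => minor (M x) k r) ∈ S := det_mem fun _ _ => hM _ _

/-- A function on `GL(m, A)` whose restriction to every rational curve is rational. -/
def IsTame (E : Type*) [Field E] [Algebra E A] [Module.Finite E A] {m : ℕ}
    (Φ : GL (Fin m) A → E) : Prop :=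
  ∀ Z : E → GL (Fin m) A, EntriesIn (rationalFunctionsAtZero E) Z →
    (fun x => Φ (Z x)) ∈ rationalFunctionsAtZero E

/-- A tame function that vanishes on a nonempty principal open subset is zero. -/
theorem IsTame.eq_zero [Infinite E] {m : ℕ} {Φ : GL (Fin m) A → E} (hΦ : IsTame E Φ) {ι : Type*}
    [Finite ι] (q : ι → Matrix (Fin m) (Fin m) A → A)
    (hq : ∀ i (Z : E → Matrix (Fin m) (Fin m) A),
      (∀ k l, (fun x => Z x k l) ∈ coordSubalgebra A (polynomialFunctions E)) →
      (fun x => q i (Z x)) ∈ coordSubalgebra A (polynomialFunctions E))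
    (Y' : GL (Fin m) A) (hY' : ∀ i, IsUnit (q i Y'))
    (h : ∀ Y : GL (Fin m) A, (∀ i, IsUnit (q i Y)) → Φ Y = 0)
    (Y : GL (Fin m) A) : Φ Y = 0 := by
  obtain ⟨Z, hZ, hZ0, Z₀, hZ₀, hZ₀1, hZZ₀⟩ := exists_line (E := E) Y Y'
  rw [← hZ0]
  refine eq_zero_of_eventually_cofinite (hΦ Z hZ) ?_
  have hu : ∀ᶠ x in cofinite, ∀ i, IsUnit (q i (Z₀ x)) := eventually_all.2 fun i =>
    eventually_isUnit_cofinite (hq i Z₀ hZ₀) (x₀ := 1) (by rw [hZ₀1]; exact hY' i)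
  filter_upwards [hu, hZZ₀] with x hx hx'
  exact h _ fun i => by rw [hx']; exact hx i

section EntriesIn

variable {X : Type*} {S : Subalgebra E (X → E)} {n : ℕ}

theorem zero_fun_mem : (fun _ => 0) ∈ coordSubalgebra (X := X) A S :=
  const_mem_coordSubalgebra S 0

theorem one_fun_mem : (fun _ => 1) ∈ coordSubalgebra (X := X) A S :=
  const_mem_coordSubalgebra S 1

theorem EntriesIn.rowGL {a : X → Fin n → A}
    (ha : ∀ k, (fun x => a x k) ∈ coordSubalgebra A S) :
    EntriesIn S fun x => ManinCongruence.rowGL (a x) := by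
  have key : ∀ b : X → Fin n → A, (∀ k, (fun x => b x k) ∈ coordSubalgebra A S) → ∀ i j,
      (fun x => (blocks 1 0 (of fun _ => b x) 1 : Matrix (Fin (n + 1)) (Fin (n + 1)) A) i j) ∈
        coordSubalgebra A S := fun b hb i j => by
    refine Fin.lastCases ?_ (fun i => ?_) i <;> refine Fin.lastCases ?_ (fun j => ?_) j
    · simpa using one_fun_mem
    · simpa using hb j
    · simpa using zero_fun_mem
    · simpa using const_mem_coordSubalgebra S _
  exact fun i j => ⟨key a ha i j, key (fun x => -a x) (fun k => neg_mem (ha k)) i j⟩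

theorem EntriesIn.colGL {a : X → Fin n → A}
    (ha : ∀ k, (fun x => a x k) ∈ coordSubalgebra A S) :
    EntriesIn S fun x => ManinCongruence.colGL (a x) := by
  have key : ∀ b : X → Fin n → A, (∀ k, (fun x => b x k) ∈ coordSubalgebra A S) → ∀ i j,
      (fun x => (blocks 1 (of fun i _ => b x i) 0 1 : Matrix (Fin (n + 1)) (Fin (n + 1)) A) i j) ∈
        coordSubalgebra A S := fun b hb i j => by
    refine Fin.lastCases ?_ (fun i => ?_) i <;> refine Fin.lastCases ?_ (fun j => ?_) j
    · simpa using one_fun_mem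
    · simpa using zero_fun_mem
    · simpa using hb i
    · simpa using const_mem_coordSubalgebra S _
  exact fun i j => ⟨key a ha i j, key (fun x => -a x) (fun k => neg_mem (ha k)) i j⟩

theorem EntriesIn.sectionGL {a : X → Fin n → A}
    (ha : ∀ k, (fun x => a x k) ∈ coordSubalgebra A S) :
    EntriesIn S fun x => ManinCongruence.sectionGL (a x) :=
  (EntriesIn.colGL ha).mul (EntriesIn.const S _)

theorem EntriesIn.diagHom {m : ℕ} {t : X → Fin m → Aˣ}
    (ht : ∀ k, (fun x => (t x k : A)) ∈ coordSubalgebra A S ∧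
      (fun x => (↑(t x k)⁻¹ : A)) ∈ coordSubalgebra A S) :
    EntriesIn S fun x => ManinCongruence.diagHom (t x) := by
  have key : ∀ b : X → Fin m → A, (∀ k, (fun x => b x k) ∈ coordSubalgebra A S) → ∀ i j,
      (fun x => (diagonal (b x)) i j) ∈ coordSubalgebra A S := fun b hb i j => by
    by_cases hij : i = j
    · subst hij
      simpa using hb i
    · simpa [hij] using zero_fun_mem
  intro i j
  refine ⟨key (fun x k => t x k) (fun k => (ht k).1) i j, ?_⟩
  simp only [← map_inv]
  exact key (fun x k => ↑(t x k)⁻¹) (fun k => (ht k).2) i j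

theorem EntriesIn.det {m : ℕ} {Z : X → GL (Fin m) A} (hZ : EntriesIn S Z) :
    (fun x => (GeneralLinearGroup.det (Z x) : A)) ∈ coordSubalgebra A S ∧
      (fun x => (↑(GeneralLinearGroup.det (Z x))⁻¹ : A)) ∈ coordSubalgebra A S := by
  refine ⟨det_mem fun i j => (hZ i j).1, ?_⟩
  simp only [← map_inv]
  exact det_mem fun i j => (hZ i j).2

/-- The diagonal matrix `diag(1, …, 1, δ)`. -/
def lastDiag (n : ℕ) {R : Type*} [CommRing R] : Rˣ →* GL (Fin (n + 1)) R :=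
  ManinCongruence.diagHom.comp
    { toFun := fun δ => Fin.snoc (α := fun _ => Rˣ) (1 : Fin n → Rˣ) δ
      map_one' := by
        funext i
        refine Fin.lastCases ?_ (fun i => ?_) i <;> simp
      map_mul' := fun δ δ' => by
        have := snoc_mul_snoc (1 : Fin n → Rˣ) 1 δ δ'
        rwa [one_mul] at this }

theorem EntriesIn.lastDiag {δ : X → Aˣ}
    (hδ : (fun x => (δ x : A)) ∈ coordSubalgebra A S ∧
      (fun x => (↑(δ x)⁻¹ : A)) ∈ coordSubalgebra A S) :
    EntriesIn S fun x => ManinCongruence.lastDiag n (δ x) := by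
  refine EntriesIn.diagHom fun k => ?_
  refine Fin.lastCases ?_ (fun k => ?_) k
  · simpa using hδ
  · simpa using one_fun_mem

end EntriesIn

namespace IsSemiInvariant

variable [Infinite E] {n : ℕ} {Φ : GL (Fin (n + 1)) A → E}
  {ψ : (Fin n → Aˣ) × (Fin (n + 1) → Aˣ) →* Eˣ}

/-- The minors that define the open cell. -/
def cellMinors (Y : Matrix (Fin (n + 1)) (Fin (n + 1)) A) (i : Fin n × Bool) : A :=
  minor Y i.1.castSucc (bif i.2 then i.1.castSucc else Fin.last n)

theorem rowGL_castSucc (x : Fin n → A) (k : Fin n) :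
    minor (rowGL x).1 k.castSucc k.castSucc = 1 := by
  rw [minor_rowGL]
  exact (rowGL_lower x _ _).1 rfl

theorem rowGL_last (x : Fin n → A) (k : Fin n) :
    minor (rowGL x).1 k.castSucc (Fin.last n) = x k := by
  rw [minor_rowGL]
  exact blocks_last_castSucc _ _ _ _ _

theorem det_rowGL (x : Fin n → A) : (rowGL x).1.det = 1 := by
  rw [← minor_last_last, minor_rowGL]
  exact (rowGL_lower x _ _).1 rfl

theorem eq_zero_of_cell {Ψ : GL (Fin (n + 1)) A → E} (hΨ : IsTame E Ψ)
    (h : ∀ (Y : GL (Fin (n + 1)) A) (d x : Fin n → Aˣ),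
      (∀ k, minor Y.1 k.castSucc k.castSucc = d k) →
      (∀ k, minor Y.1 k.castSucc (Fin.last n) = x k) → Ψ Y = 0)
    (Y : GL (Fin (n + 1)) A) : Ψ Y = 0 := by
  refine hΨ.eq_zero (fun i Y => cellMinors Y i) (fun i Z hZ => minor_mem hZ _ _) (rowGL 1)
    (fun i => ?_) (fun (Y : GL (Fin (n + 1)) A) hY => ?_) Y
  · obtain ⟨k, b⟩ := i
    cases b
    · exact (congrArg IsUnit (rowGL_last 1 k)).mpr isUnit_one
    · exact (congrArg IsUnit (rowGL_castSucc 1 k)).mpr isUnit_one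
  · choose u hu using hY
    exact h Y (fun k => u (k, true)) (fun k => u (k, false)) (fun k => (hu (k, true)).symm)
      fun k => (hu (k, false)).symm

/-- The open orbit is dense: a semi-invariant function that vanishes at the base point is zero. -/
theorem eq_zero (hΦ : IsSemiInvariant Φ ψ) (ht : IsTame E Φ) (h : Φ (rowGL 1) = 0)
    (Y : GL (Fin (n + 1)) A) : Φ Y = 0 :=
  eq_zero_of_cell ht (fun Y _ _ hd hx => by
    rw [hΦ.eq_of_isUnit_minors Y hd hx (δ := GeneralLinearGroup.det Y) rfl, h, mul_zero]) Y

theorem sectionGL_of_units (hΦ : IsSemiInvariant Φ ψ) (d : Fin n → Aˣ) :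
    Φ (sectionGL fun k => (d k : A)) = ψ (cellTorus (d, 1, 1)) * Φ (rowGL 1) := by
  refine hΦ.eq_of_isUnit_minors _ (fun k => ?_) (fun k => ?_) ?_
  · rw [minor_sectionGL _ le_rfl, Fin.snoc_castSucc]
  · rw [minor_sectionGL _ (Fin.le_last _), Fin.snoc_last]
    rfl
  · rw [← minor_last_last, minor_sectionGL _ le_rfl, Fin.snoc_last]
    rfl

theorem rowGL_of_units (hΦ : IsSemiInvariant Φ ψ) (x : Fin n → Aˣ) :
    Φ (rowGL fun k => (x k : A)) = ψ (cellTorus (1, x, 1)) * Φ (rowGL 1) := by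
  refine hΦ.eq_of_isUnit_minors _ (fun k => ?_) (fun k => ?_) ?_
  · rw [rowGL_castSucc]
    rfl
  · rw [rowGL_last]
  · rw [det_rowGL]
    rfl

theorem lastDiag_eq (hΦ : IsSemiInvariant Φ ψ) (δ : Aˣ) :
    Φ (rowGL 1 * lastDiag n δ) = ψ (cellTorus (1, 1, δ)) * Φ (rowGL 1) := by
  have h : lastDiag n δ = diagHom (Fin.snoc (α := fun _ => Aˣ) (1 : Fin n → Aˣ) δ) := rfl
  have hm : ∀ k : Fin n, ∏ i, ((Fin.snoc (α := fun _ => Aˣ) (1 : Fin n → Aˣ) δ :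
      Fin (n + 1) → Aˣ) (firstIndices k.castSucc i) : A) = 1 := fun k =>
    Finset.prod_eq_one fun i _ => by
      have hi : firstIndices k.castSucc i =
          Fin.castSucc (⟨i, lt_of_lt_of_le i.2 k.2⟩ : Fin n) := rfl
      rw [hi, Fin.snoc_castSucc]
      rfl
  refine hΦ.eq_of_isUnit_minors _ (fun k => ?_) (fun k => ?_) ?_
  · rw [Units.val_mul, h, diagHom_val, minor_mul_diagonal, hm, rowGL_castSucc,
      mul_one]
    rfl
  · rw [Units.val_mul, h, diagHom_val, minor_mul_diagonal, hm, rowGL_last,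
      mul_one]
    rfl
  · rw [Units.val_mul, det_mul, det_rowGL, h, diagHom_val, det_diagonal, Fin.prod_univ_castSucc]
    simp

/-- The vanishing spreads from tuples of units to all tuples along the lines from a and b to (1, …,
1), whose entries are units for almost all parameters. -/
theorem eq_of_lines {φ : (Fin n → A) → (Fin n → A) → E}
    (hφ : ∀ a b : E → Fin n → A,
      (∀ k, (fun x => a x k) ∈ coordSubalgebra A (rationalFunctionsAtZero E)) →
      (∀ k, (fun x => b x k) ∈ coordSubalgebra A (rationalFunctionsAtZero E)) →
      (fun x => φ (a x) (b x)) ∈ rationalFunctionsAtZero E)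
    (h : ∀ a b : Fin n → Aˣ, φ (fun k => a k) (fun k => b k) = 0) (a b : Fin n → A) :
    φ a b = 0 := by
  let l : (Fin n → A) → E → Fin n → A := fun a x => a + x • (1 - a)
  have hl : ∀ a k, (fun x => l a x k) ∈ coordSubalgebra A (polynomialFunctions E) := fun a k =>
    add_mem (const_mem_coordSubalgebra _ _)
      (smul_mem_coordSubalgebra id_mem_polynomialFunctions _)
  have hu : ∀ a, ∀ᶠ x in cofinite, ∀ k, IsUnit (l a x k) := fun a => eventually_all.2 fun k =>
    eventually_isUnit_cofinite (hl a k) (x₀ := 1) (by simp [l])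
  have h0 : ∀ a, l a 0 = a := fun a => by simp [l]
  have := eq_zero_of_eventually_cofinite (hφ (l a) (l b)
    (fun k => coordSubalgebra_mono polynomialFunctions_le (hl a k))
    (fun k => coordSubalgebra_mono polynomialFunctions_le (hl b k))) (by
      filter_upwards [hu a, hu b] with x hx hx'
      choose u hu using hx
      choose v hv using hx'
      have h1 : l a x = fun k => (u k : A) := funext fun k => (hu k).symm
      have h2 : l b x = fun k => (v k : A) := funext fun k => (hv k).symm
      rw [h1, h2]
      exact h u v)
  simpa only [h0] using this

/-- On tuples of units this is the multiplicativity of the character in `sectionGL_of_units`. Both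
sides make sense for all tuples and are rational along lines, so the identity extends. -/
theorem sectionGL_mul (hΦ : IsSemiInvariant Φ ψ) (ht : IsTame E Φ) (a b : Fin n → A) :
    Φ (sectionGL (a * b)) * Φ (rowGL 1) = Φ (sectionGL a) * Φ (sectionGL b) := by
  rw [← sub_eq_zero]
  refine eq_of_lines (φ := fun a b => Φ (sectionGL (a * b)) * Φ (rowGL 1) -
    Φ (sectionGL a) * Φ (sectionGL b)) (fun a b ha hb => ?_) (fun a b => ?_) a b
  · exact sub_mem (mul_mem (ht _ (EntriesIn.sectionGL fun k => mul_mem (ha k) (hb k)))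
      (Subalgebra.algebraMap_mem _ (Φ (rowGL 1))))
      (mul_mem (ht _ (EntriesIn.sectionGL ha)) (ht _ (EntriesIn.sectionGL hb)))
  · have hab : ((fun k => (a k : A)) * fun k => (b k : A)) = fun k => ((a * b) k : A) := rfl
    have hc : ((a * b, 1, 1) : (Fin n → Aˣ) × (Fin n → Aˣ) × Aˣ) = (a, 1, 1) * (b, 1, 1) := by
      simp
    simp only [hab, hΦ.sectionGL_of_units, hc, map_mul, Units.val_mul]
    ring

theorem rowGL_mul (hΦ : IsSemiInvariant Φ ψ) (ht : IsTame E Φ) (a b : Fin n → A) :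
    Φ (rowGL (a * b)) * Φ (rowGL 1) = Φ (rowGL a) * Φ (rowGL b) := by
  rw [← sub_eq_zero]
  refine eq_of_lines (φ := fun a b => Φ (rowGL (a * b)) * Φ (rowGL 1) -
    Φ (rowGL a) * Φ (rowGL b)) (fun a b ha hb => ?_) (fun a b => ?_) a b
  · exact sub_mem (mul_mem (ht _ (EntriesIn.rowGL fun k => mul_mem (ha k) (hb k)))
      (Subalgebra.algebraMap_mem _ (Φ (rowGL 1))))
      (mul_mem (ht _ (EntriesIn.rowGL ha)) (ht _ (EntriesIn.rowGL hb)))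
  · have hab : ((fun k => (a k : A)) * fun k => (b k : A)) = fun k => ((a * b) k : A) := rfl
    have hc : ((1, a * b, 1) : (Fin n → Aˣ) × (Fin n → Aˣ) × Aˣ) = (1, a, 1) * (1, b, 1) := by
      simp
    simp only [hab, hΦ.rowGL_of_units, hc, map_mul, Units.val_mul]
    ring

theorem lastDiag_mul (hΦ : IsSemiInvariant Φ ψ) (δ δ' : Aˣ) :
    Φ (rowGL 1 * lastDiag n (δ * δ')) * Φ (rowGL 1) =
      Φ (rowGL 1 * lastDiag n δ) * Φ (rowGL 1 * lastDiag n δ') := by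
  have hc : ((1, 1, δ * δ') : (Fin n → Aˣ) × (Fin n → Aˣ) × Aˣ) = (1, 1, δ) * (1, 1, δ') := by
    simp
  rw [hΦ.lastDiag_eq, hΦ.lastDiag_eq, hΦ.lastDiag_eq, hc, map_mul, map_mul, Units.val_mul]
  ring

/-- A semi-invariant function is a product of three functions of the minors. -/
theorem mul_sq_eq (hΦ : IsSemiInvariant Φ ψ) (ht : IsTame E Φ) (Y : GL (Fin (n + 1)) A) :
    Φ Y * Φ (rowGL 1) ^ 2 = Φ (sectionGL fun k => minor Y.1 k.castSucc k.castSucc) *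
      Φ (rowGL fun k => minor Y.1 k.castSucc (Fin.last n)) *
      Φ (rowGL 1 * lastDiag n (GeneralLinearGroup.det Y)) := by
  rw [← sub_eq_zero]
  refine eq_zero_of_cell (Ψ := fun Y => Φ Y * Φ (rowGL 1) ^ 2 -
      Φ (sectionGL fun k => minor Y.1 k.castSucc k.castSucc) *
      Φ (rowGL fun k => minor Y.1 k.castSucc (Fin.last n)) *
      Φ (rowGL 1 * lastDiag n (GeneralLinearGroup.det Y))) (fun Z hZ => ?_)
      (fun Y d x hd hx => ?_) Y
  · refine sub_mem (mul_mem (ht Z hZ) (Subalgebra.algebraMap_mem _ (Φ (rowGL 1) ^ 2)))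
      (mul_mem (mul_mem (ht _ (EntriesIn.sectionGL fun k => minor_mem (fun i j => (hZ i j).1) _ _))
        (ht _ (EntriesIn.rowGL fun k => minor_mem (fun i j => (hZ i j).1) _ _)))
        (ht _ ((EntriesIn.const _ _).mul (EntriesIn.lastDiag hZ.det))))
  · simp only [hd, hx]
    have hc : (d, x, GeneralLinearGroup.det Y) =
        ((d, 1, 1) * (1, x, 1) * (1, 1, GeneralLinearGroup.det Y) :
          (Fin n → Aˣ) × (Fin n → Aˣ) × Aˣ) := by simp
    rw [hΦ.eq_of_isUnit_minors Y hd hx (δ := GeneralLinearGroup.det Y) rfl,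
      hΦ.sectionGL_of_units, hΦ.rowGL_of_units, hΦ.lastDiag_eq, hc, map_mul, map_mul, map_mul,
      map_mul, Units.val_mul, Units.val_mul]
    ring

/-- Two values of a semi-invariant function are compared by comparing the minors. -/
theorem mul_pow_three_eq (hΦ : IsSemiInvariant Φ ψ) (ht : IsTame E Φ) (h0 : Φ (rowGL 1) ≠ 0)
    {Y Y' : GL (Fin (n + 1)) A} {a b : Fin n → A} {δ : Aˣ}
    (ha : ∀ k, minor Y.1 k.castSucc k.castSucc = minor Y'.1 k.castSucc k.castSucc * a k)
    (hb : ∀ k, minor Y.1 k.castSucc (Fin.last n) = minor Y'.1 k.castSucc (Fin.last n) * b k)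
    (hδ : GeneralLinearGroup.det Y = GeneralLinearGroup.det Y' * δ) :
    Φ Y * Φ (rowGL 1) ^ 3 =
      Φ Y' * (Φ (sectionGL a) * Φ (rowGL b) * Φ (rowGL 1 * lastDiag n δ)) := by
  have h1 := hΦ.mul_sq_eq ht Y
  have h2 := hΦ.mul_sq_eq ht Y'
  simp only [ha, hb, hδ] at h1
  have h3 := hΦ.sectionGL_mul ht (fun k => minor Y'.1 k.castSucc k.castSucc) a
  have h4 := hΦ.rowGL_mul ht (fun k => minor Y'.1 k.castSucc (Fin.last n)) b
  have h5 := hΦ.lastDiag_mul (GeneralLinearGroup.det Y') δ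
  -- Both values are expressed by `mul_sq_eq`, which carries the square of the value at the base
  -- point. Then each of the three factors is split by multiplicativity.
  refine mul_right_cancel₀ (pow_ne_zero 2 h0) ?_
  simp only [Pi.mul_def] at h3 h4
  linear_combination (Φ (rowGL 1)) ^ 3 * h1 - (Φ (sectionGL a) * Φ (rowGL b) *
    Φ (rowGL 1 * lastDiag n δ)) * h2 + Φ (rowGL 1 * lastDiag n (GeneralLinearGroup.det Y' * δ)) *
    Φ (rowGL 1) * Φ (rowGL 1) * Φ (rowGL fun k => minor Y'.1 k.castSucc (Fin.last n) * b k) * h3 +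
    Φ (rowGL 1 * lastDiag n (GeneralLinearGroup.det Y' * δ)) * Φ (rowGL 1) *
    (Φ (sectionGL fun k => minor Y'.1 k.castSucc k.castSucc) * Φ (sectionGL a)) * h4 +
    (Φ (sectionGL fun k => minor Y'.1 k.castSucc k.castSucc) * Φ (sectionGL a)) *
    (Φ (rowGL fun k => minor Y'.1 k.castSucc (Fin.last n)) * Φ (rowGL b)) * h5

end IsSemiInvariant

end Density

/-! ### Conjugation by the longest Weyl element -/

section Reversal

open Matrix

variable {R : Type*} [CommRing R] {m n : ℕ}

/-- The antidiagonal permutation matrix as an element of `GL(m)`. -/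
def wGL (m : ℕ) (R : Type*) [CommRing R] : GL (Fin m) R where
  val := wMatrix m R
  inv := wMatrix m R
  val_inv := wMatrix_mul_self
  inv_val := wMatrix_mul_self

theorem wMatrix_mul (M : Matrix (Fin m) (Fin m) R) : wMatrix m R * M = M.submatrix Fin.rev id := by
  ext i j
  simp [wMatrix, mul_apply]

theorem mul_wMatrix (M : Matrix (Fin m) (Fin m) R) : M * wMatrix m R = M.submatrix id Fin.rev := by
  ext i j
  simp only [wMatrix, mul_apply, of_apply, mul_ite, mul_one, mul_zero, submatrix_apply, id]
  rw [Finset.sum_eq_single j.rev]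
  · simp
  · intro k _ hk
    rw [if_neg]
    rintro rfl
    simp at hk
  · simp

theorem wGL_mul_self : wGL m R * wGL m R = 1 := Units.ext wMatrix_mul_self

theorem wGL_conj_apply (g : GL (Fin m) R) (i j : Fin m) :
    (wGL m R * g * wGL m R) i j = g i.rev j.rev := by
  change (wMatrix m R * g.1 * wMatrix m R) i j = _
  rw [wMatrix_mul, mul_wMatrix]
  rfl

theorem wGL_conj_upper {g : GL (Fin m) R} (hg : IsUpperUnipotent g) :
    IsLowerUnipotent (wGL m R * g * wGL m R) := fun i j => by
  rw [wGL_conj_apply]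
  exact ⟨fun h => (hg _ _).1 (h ▸ rfl), fun h => (hg _ _).2 (Fin.rev_lt_rev.2 h)⟩

theorem wGL_conj_lower {g : GL (Fin m) R} (hg : IsLowerUnipotent g) :
    IsUpperUnipotent (wGL m R * g * wGL m R) := fun i j => by
  rw [wGL_conj_apply]
  exact ⟨fun h => (hg _ _).1 (h ▸ rfl), fun h => (hg _ _).2 (Fin.rev_lt_rev.2 h)⟩

theorem wGL_conj_diagHom (t : Fin m → Rˣ) :
    wGL m R * diagHom t * wGL m R = diagHom (t ∘ Fin.rev) := by
  ext i j
  rw [wGL_conj_apply, diagHom_val, diagHom_val, diagonal_apply, diagonal_apply]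
  simp

/-- The signs relating `h` and the base point of the section. -/
def hSigns (n : ℕ) (R : Type*) [CommRing R] : Fin (n + 1) → Rˣ :=
  Fin.cons (α := fun _ => Rˣ) 1 fun j => -tEntries n (-1) j.rev

/-- Up to signs, h lies on the section at the tuple (1, …, 1). All its relevant minors are therefore
±1, and it belongs to the open orbit. -/
theorem hElement_fst_mul_wGL :
    (hElement n R).1 * wGL (n + 1) R = sectionGL 1 * diagHom (hSigns n R) := by
  have h : (hElement n R).1.1 =
      blocks (wMatrix n R * diagonal fun i => (tEntries n (-1 : Rˣ) i : R)) (onesCol n R) 0 1 := by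
    change blocks _ _ _ _ * blocks _ _ _ _ = _
    rw [blocks_mul]
    simp
    rfl
  ext i j
  change ((hElement n R).1.1 * wMatrix (n + 1) R) i j =
    ((sectionGL (1 : Fin n → R)).1 * diagonal fun i => (hSigns n R i : R) :
      Matrix (Fin (n + 1)) (Fin (n + 1)) R) i j
  rw [mul_wMatrix, mul_diagonal, submatrix_apply, id, h]
  refine Fin.cases ?_ (fun j => ?_) j
  · rw [sectionGL_zero, Fin.rev_zero, hSigns, Fin.cons_zero, Units.val_one, mul_one]
    refine Fin.lastCases ?_ (fun i => ?_) i <;> simp [onesCol]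
  · rw [sectionGL_succ, Fin.rev_succ, hSigns, Fin.cons_succ]
    refine Fin.lastCases ?_ (fun i => ?_) i
    · simp [(Fin.castSucc_ne_last _).symm]
    · rw [blocks_castSucc_castSucc, mul_diagonal, wMatrix, of_apply]
      simp only [Fin.rev_inj, Fin.castSucc_inj, Units.val_neg, ite_mul, one_mul, zero_mul,
        eq_comm (a := j)]
      split_ifs <;> simp

end Reversal

/-! ### Semi-invariant functions attached to equivariant functionals -/

section Representations

open Matrix Filter

variable {E A V : Type*} [Field E] [CommRing A] [Algebra E A] [Module.Finite E A]
  [AddCommGroup V] [Module E V] {n : ℕ}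

/-- A rational representation of `GL(n+1, A) × GL(n, A)` generated by an eigenvector of the
lower triangular Borel subgroup. -/
structure IsLowerCyclic (ρ : Representation E (GLPair n A) V) (χ : Torus n A →* Eˣ) (v₀ : V) :
    Prop where
  unipotent : ∀ g : GLPair n A, IsLowerUnipotent g.1 → IsLowerUnipotent g.2 → ρ g v₀ = v₀
  torus : ∀ t, ρ (torusHom t) v₀ = (χ t : E) • v₀
  rational : ∀ (v : V) (l : V →ₗ[E] E), (fun g => l (ρ g v)) ∈ regularAlgebra n E A
  cyclic : ∀ l : V →ₗ[E] E, (∀ g, l (ρ g v₀) = 0) → l = 0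

/-- The functional `η` transforms under `GL(n, A)` by the `j`-th power of the norm character. -/
def IsNormEquivariant (ρ : Representation E (GLPair n A) V) (j : ℤ) (η : V →ₗ[E] E) : Prop :=
  ∀ (g : GL (Fin n) A) (v : V),
    η (ρ (deltaHom g) v) = Algebra.norm E (GeneralLinearGroup.det g : A) ^ j * η v

theorem isLowerUnipotent_one {R : Type*} [CommRing R] {m : ℕ} :
    IsLowerUnipotent (1 : GL (Fin m) R) := fun i j =>
  ⟨fun h => by simp [h], fun h => by simp [h.ne]⟩

/-- The function on `GL(n+1, A)` attached to a functional. -/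
def cellFunction (ρ : Representation E (GLPair n A) V) (v₀ : V) (η : V →ₗ[E] E)
    (Y : GL (Fin (n + 1)) A) : E := η (ρ (Y, 1) (ρ (wGL (n + 1) A, 1) v₀))

/-- The character by which the function attached to a functional transforms. -/
noncomputable def cellCharacter (χ : Torus n A →* Eˣ) (j : ℤ) :
    (Fin n → Aˣ) × (Fin (n + 1) → Aˣ) →* Eˣ :=
  MonoidHom.mk' (fun t => Units.map (Algebra.norm E) (GeneralLinearGroup.det (diagHom t.1)) ^ j *
      χ (t.2 ∘ Fin.rev, t.1⁻¹)) fun s t => by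
    have h : (((s * t).2 ∘ Fin.rev, (s * t).1⁻¹) : Torus n A) =
        (s.2 ∘ Fin.rev, s.1⁻¹) * (t.2 ∘ Fin.rev, t.1⁻¹) := by
      refine Prod.ext rfl ?_
      simp [mul_comm]
    rw [h, Prod.fst_mul, map_mul, map_mul, map_mul, map_mul, mul_zpow, mul_mul_mul_comm]

namespace IsLowerCyclic

variable {ρ : Representation E (GLPair n A) V} {χ : Torus n A →* Eˣ} {v₀ : V}
  (h : IsLowerCyclic ρ χ v₀) {j : ℤ} {η : V →ₗ[E] E} (hη : IsNormEquivariant ρ j η)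

include h

theorem isTame (η : V →ₗ[E] E) : IsTame E (cellFunction ρ v₀ η) := fun Z hZ =>
  comp_mem_of_mem_regularAlgebra (μ := fun x => (Z x, 1)) hZ (EntriesIn.const _ _)
    (h.rational _ _)

include hη

/-- On the left, j(c) is completed to Δ(c) at the price of (1, c⁻¹), which acts on v₀ through the
lower Borel group. On the right, conjugation by w turns upper triangular matrices into lower
triangular ones. -/
theorem isSemiInvariant : IsSemiInvariant (cellFunction ρ v₀ η) (cellCharacter χ j) where
  lower c Y hc := by
    have h1 : ρ ((1, c⁻¹) : GLPair n A) v₀ = v₀ := by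
      have h2 := h.unipotent (1, c) isLowerUnipotent_one hc
      have h3 : ((1, c⁻¹) : GLPair n A) = (1, c)⁻¹ := by simp
      conv_lhs => rw [← h2, h3]
      rw [← Module.End.mul_apply, ← map_mul, inv_mul_cancel, map_one, Module.End.one_apply]
    have h2 : ((jHom c * Y, 1) * (wGL (n + 1) A, 1) : GLPair n A) =
        deltaHom c * ((Y, 1) * (wGL (n + 1) A, 1)) * (1, c⁻¹) := by
      simp [deltaHom, mul_assoc]
    have hdet : GeneralLinearGroup.det c = 1 := Units.ext (by
      change c.1.det = 1
      rw [det_of_isLowerTriangular c.1 fun i j hij => (hc i j).2 hij]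
      simp [(hc _ _).1 rfl])
    rw [cellFunction, ← Module.End.mul_apply, ← map_mul, h2, map_mul, Module.End.mul_apply, h1,
      map_mul, Module.End.mul_apply, hη, hdet, map_mul, Module.End.mul_apply]
    simp [cellFunction]
  upper b Y hb := by
    have h1 : ((Y * b, 1) * (wGL (n + 1) A, 1) : GLPair n A) =
        (Y, 1) * (wGL (n + 1) A, 1) * (wGL (n + 1) A * b * wGL (n + 1) A, 1) := by
      refine Prod.ext ?_ (by simp)
      change Y * b * wGL (n + 1) A = Y * wGL (n + 1) A * (wGL (n + 1) A * b * wGL (n + 1) A)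
      rw [mul_assoc (wGL (n + 1) A), mul_assoc Y (wGL (n + 1) A),
        ← mul_assoc (wGL (n + 1) A) (wGL (n + 1) A), wGL_mul_self, one_mul, mul_assoc]
    rw [cellFunction, ← Module.End.mul_apply, ← map_mul, h1, map_mul, Module.End.mul_apply,
      h.unipotent _ (wGL_conj_upper hb) isLowerUnipotent_one, map_mul, Module.End.mul_apply,
      cellFunction]
  torus t Y := by
    have h1 : ((jHom (diagHom t.1) * Y * diagHom t.2, 1) * (wGL (n + 1) A, 1) : GLPair n A) =
        deltaHom (diagHom t.1) * ((Y, 1) * (wGL (n + 1) A, 1)) *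
          torusHom (t.2 ∘ Fin.rev, t.1⁻¹) := by
      refine Prod.ext ?_ ?_
      · change jHom (diagHom t.1) * Y * diagHom t.2 * wGL (n + 1) A =
          jHom (diagHom t.1) * (Y * wGL (n + 1) A) * diagHom (t.2 ∘ Fin.rev)
        rw [← wGL_conj_diagHom]
        simp only [mul_assoc]
        rw [← mul_assoc (wGL (n + 1) A) (wGL (n + 1) A), wGL_mul_self, one_mul]
      · change (1 : GL (Fin n) A) * 1 = diagHom t.1 * (1 * 1) * diagHom t.1⁻¹
        rw [map_inv]
        simp
    rw [cellFunction, ← Module.End.mul_apply, ← map_mul, h1, map_mul, Module.End.mul_apply,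
      h.torus, map_smul, map_smul, map_mul, Module.End.mul_apply, hη, map_mul,
      Module.End.mul_apply]
    simp [cellFunction, cellCharacter]
    ring

/-- Pulling out Δ(g₂) leaves an element with trivial second component, so the function on GL(n+1)
alone determines η on the orbit of v₀. -/
theorem apply_eq (g : GLPair n A) : η (ρ g v₀) =
    Algebra.norm E (GeneralLinearGroup.det g.2 : A) ^ j *
      cellFunction ρ v₀ η ((jHom g.2)⁻¹ * g.1 * wGL (n + 1) A) := by
  have h1 : g = deltaHom g.2 * (((jHom g.2)⁻¹ * g.1 * wGL (n + 1) A, 1) * (wGL (n + 1) A, 1)) := by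
    refine Prod.ext ?_ ?_
    · change g.1 = jHom g.2 * ((jHom g.2)⁻¹ * g.1 * wGL (n + 1) A * wGL (n + 1) A)
      rw [mul_assoc _ (wGL (n + 1) A), wGL_mul_self]
      group
    · change g.2 = g.2 * (1 * 1)
      simp
  conv_lhs => rw [h1, map_mul, Module.End.mul_apply, hη, map_mul, Module.End.mul_apply]
  rfl

variable [Infinite E]

/-- If the value at the base point vanished, density would make η vanish on the whole orbit of v₀,
which generates V. -/
theorem cellFunction_ne_zero (h0 : η ≠ 0) : cellFunction ρ v₀ η (rowGL 1) ≠ 0 := fun h1 =>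
  h0 (h.cyclic η fun g => by
    rw [h.apply_eq hη, (h.isSemiInvariant hη).eq_zero (h.isTame η) h1, mul_zero])

theorem apply_hElement_ne_zero (h0 : η ≠ 0) : η (ρ (hElement n A) v₀) ≠ 0 := by
  have hs := h.isSemiInvariant hη
  have h1 := h.apply_eq hη (hElement n A)
  have h2 : (hElement n A).2 = 1 := rfl
  have h3 := hs.torus (1, hSigns n A) (sectionGL 1)
  have h4 := hs.sectionGL_of_units 1
  simp only [map_one, one_mul] at h3
  have h5 : (fun k : Fin n => (((1 : Fin n → Aˣ) k : Aˣ) : A)) = 1 := rfl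
  rw [h1, h2, map_one, map_one jHom, inv_one, one_mul, hElement_fst_mul_wGL, h3, ← h5, h4]
  simpa using h.cellFunction_ne_zero hη h0

end IsLowerCyclic

end Representations

/-! ### Divisibility of the minors of diag(G₂, 1) D H D G₁ -/

section Divisibility

open Matrix

variable {S : Type*} [CommRing S] {n : ℕ}

/-- The matrix `diag(1, x, …, x ^ n)`. -/
def powDiag (n : ℕ) (x : S) : Matrix (Fin (n + 1)) (Fin (n + 1)) S :=
  diagonal fun i : Fin (n + 1) => x ^ (i : ℕ)

/-- The matrix `diag(G₂, 1) D H D G₁` with `D = diag(1, x, …, x ^ n)`. -/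
def contracted (x : S) (H : Matrix (Fin (n + 1)) (Fin (n + 1)) S) (G₂ : Matrix (Fin n) (Fin n) S)
    (G₁ : Matrix (Fin (n + 1)) (Fin (n + 1)) S) : Matrix (Fin (n + 1)) (Fin (n + 1)) S :=
  blocks G₂ 0 0 1 * powDiag n x * (H * powDiag n x * G₁)

/-- Each D contributes a sum of distinct exponents. The right one gives at least 0 + … + k. The left
one gives at least 0 + … + (k-1) + r; for r = n this uses that the last row of diag(G₂, 1) is the
last unit vector, which forces the exponent n. -/
theorem pow_dvd_minor_contracted (x : S) (H : Matrix (Fin (n + 1)) (Fin (n + 1)) S)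
    (G₂ : Matrix (Fin n) (Fin n) S) (G₁ : Matrix (Fin (n + 1)) (Fin (n + 1)) S)
    (k r : Fin (n + 1)) (hr : r = k ∨ r = Fin.last n) :
    x ^ (∑ i : Fin k, (i : ℕ) + r) * x ^ (∑ i : Fin (k + 1 : ℕ), (i : ℕ)) ∣
      minor (contracted x H G₂ G₁) k r := by
  have h : (contracted x H G₂ G₁).submatrix (rowIndices k r) (firstIndices k) =
      (blocks G₂ 0 0 1).submatrix (rowIndices k r) id * powDiag n x *
        (H * powDiag n x * G₁.submatrix id (firstIndices k)) := by
    rfl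
  rw [minor, h]
  refine pow_mul_dvd_det x _ _ _ _ _ (fun φ hφ hne => ?_) fun φ => ?_
  · obtain rfl | rfl := hr
    · have := sum_le_sum_of_injective (fun i => (φ i : ℕ)) fun i j hij => hφ (Fin.ext hij)
      rwa [Fin.sum_univ_castSucc] at this
    · have hlast : φ (Fin.last _) = Fin.last n := by
        by_contra hcon
        obtain ⟨j, hj⟩ := Fin.exists_castSucc_eq.2 hcon
        refine hne (Fin.last _) ?_
        rw [submatrix_apply, rowIndices_last, id, ← hj, blocks_last_castSucc]
        rfl
      have := sum_le_sum_of_injective (fun i : Fin k => (φ i.castSucc : ℕ)) fun i j hij =>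
        Fin.castSucc_injective _ (hφ (Fin.ext hij))
      rw [Fin.sum_univ_castSucc, hlast]
      exact add_le_add this le_rfl
  · have h2 : (H * powDiag n x * G₁.submatrix id (firstIndices k)).submatrix
        φ id = H.submatrix φ id * powDiag n x *
          G₁.submatrix id (firstIndices k) := by
      rfl
    rw [h2]
    have := pow_mul_dvd_det x 1 _ (fun i : Fin (n + 1) => (i : ℕ)) (H.submatrix φ id)
      (G₁.submatrix id (firstIndices k))
      (fun θ hθ _ => sum_le_sum_of_injective (fun i => (θ i : ℕ)) fun i j hij => hθ (Fin.ext hij))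
      fun θ => one_dvd _
    rwa [mul_one] at this

/-- For G₁ = G₂ = 1 the lower bound for the exponent is attained with a unit as coefficient, so
every other minor is a multiple of this one. -/
theorem minor_contracted_one (x : S) (b : Fin (n + 1) → Sˣ) {k r : Fin (n + 1)} (h : k ≤ r) :
    minor (contracted x (sectionGL 1 * diagHom b : GL (Fin (n + 1)) S).1 1 1) k r =
      x ^ (∑ i : Fin k, (i : ℕ) + r) * x ^ (∑ i : Fin (k + 1 : ℕ), (i : ℕ)) *
        (↑(∏ i, b (firstIndices k i)) : S) := by
  rw [contracted, blocks_one, Matrix.one_mul, Matrix.mul_one, powDiag, minor_diagonal_mul,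
    minor_mul_diagonal, Units.val_mul, diagHom_val, minor_mul_diagonal, minor_sectionGL _ h]
  have h1 : (Fin.snoc (α := fun _ => S) (1 : Fin n → S) 1 r : S) = 1 := by
    refine Fin.lastCases ?_ (fun r => ?_) r <;> simp
  simp only [h1, Finset.prod_pow_eq_pow_sum, pow_add, Units.coe_prod, val_firstIndices,
    Fin.val_castLE]
  ring

theorem exists_minor_contracted_eq (x : S) (b : Fin (n + 1) → Sˣ) (G₂ : Matrix (Fin n) (Fin n) S)
    (G₁ : Matrix (Fin (n + 1)) (Fin (n + 1)) S) (k r : Fin (n + 1))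
    (hr : r = k ∨ r = Fin.last n) :
    ∃ a, minor (contracted x (sectionGL 1 * diagHom b : GL (Fin (n + 1)) S).1 G₂ G₁) k r =
      minor (contracted x (sectionGL 1 * diagHom b : GL (Fin (n + 1)) S).1 1 1) k r * a := by
  obtain ⟨a, ha⟩ := pow_dvd_minor_contracted x (sectionGL 1 * diagHom b : GL (Fin (n + 1)) S).1
    G₂ G₁ k r hr
  have hkr : k ≤ r := by
    obtain rfl | rfl := hr
    · exact le_rfl
    · exact Fin.le_last _
  refine ⟨↑(∏ i, b (firstIndices k i))⁻¹ * a, ?_⟩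
  rw [minor_contracted_one x b hkr, ha, ← mul_assoc, Units.mul_inv_cancel_right]

end Divisibility

/-! ### Compatibility with ring homomorphisms -/

section Naturality

open Matrix

variable {R S : Type*} [CommRing R] [CommRing S] (f : R →+* S) {n m : ℕ}

theorem blocks_map (a : Matrix (Fin n) (Fin n) R) (b : Matrix (Fin n) (Fin 1) R)
    (c : Matrix (Fin 1) (Fin n) R) (d : Matrix (Fin 1) (Fin 1) R) :
    (blocks a b c d).map f = blocks (a.map f) (b.map f) (c.map f) (d.map f) := by
  refine blocks_ext _ _ _ _ (fun i j => ?_) (fun i => ?_) (fun j => ?_) ?_ <;> simp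

theorem jHom_map (g : GL (Fin n) R) :
    GeneralLinearGroup.map f (jHom g) = jHom (GeneralLinearGroup.map f g) := by
  refine Units.ext ?_
  change (blocks g.1 0 0 1).map f = blocks (g.1.map f) 0 0 1
  rw [blocks_map]
  simp

theorem diagHom_map (t : Fin m → Rˣ) : GeneralLinearGroup.map f (diagHom t) =
    diagHom fun i => Units.map f.toMonoidHom (t i) := by
  refine Units.ext ?_
  change (diagonal fun i => (t i : R)).map f = diagonal _
  rw [diagonal_map (map_zero f)]
  rfl

theorem rowGL_map (x : Fin n → R) :
    GeneralLinearGroup.map f (rowGL x) = rowGL fun k => f (x k) := by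
  refine Units.ext ?_
  change (blocks 1 0 (of fun _ => x) 1).map f = blocks 1 0 (of fun _ k => f (x k)) 1
  rw [blocks_map]
  simp
  rfl

theorem sectionGL_map (d : Fin n → R) :
    GeneralLinearGroup.map f (sectionGL d) = sectionGL fun k => f (d k) := by
  ext i j
  rw [GeneralLinearGroup.map_apply]
  refine Fin.cases ?_ (fun j => ?_) j
  · rw [sectionGL_zero, sectionGL_zero]
    refine Fin.lastCases ?_ (fun i => ?_) i <;> simp
  · rw [sectionGL_succ, sectionGL_succ]
    split_ifs <;> simp

theorem lastDiag_map (δ : Rˣ) : GeneralLinearGroup.map f (lastDiag n δ) =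
    lastDiag n (Units.map f.toMonoidHom δ) := by
  refine (diagHom_map f _).trans (congrArg diagHom (funext fun i => ?_))
  refine Fin.lastCases ?_ (fun i => ?_) i <;> simp

theorem wGL_map : GeneralLinearGroup.map f (wGL m R) = wGL m S := by
  ext i j
  rw [GeneralLinearGroup.map_apply]
  simp [wGL, wMatrix, apply_ite f]

theorem hSigns_map (i : Fin (n + 1)) :
    Units.map f.toMonoidHom (hSigns n R i) = hSigns n S i := by
  refine Fin.cases ?_ (fun i => ?_) i
  · simp [hSigns]
  · refine Units.ext ?_
    simp [hSigns, tEntries]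

end Naturality

/-! ### The contracted form of h t g -/

section Contraction

open Matrix

variable {A : Type*} [CommRing A] {n : ℕ}

/-- The element `diag(1, σ, …, σ ^ n)`. -/
def powGL (n : ℕ) (σ : Aˣ) : GL (Fin (n + 1)) A := diagHom fun i => σ ^ (i : ℕ)

theorem powGL_val (σ : Aˣ) : (powGL n σ).1 = powDiag n (σ : A) := by
  rw [powGL, diagHom_val, powDiag]
  simp

theorem jHom_diagHom_tEntries (σ : Aˣ) : jHom (diagHom (tEntries n σ)) =
    diagHom (Fin.snoc (α := fun _ => Aˣ) (tEntries n σ) 1) :=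
  (congrArg Prod.fst (torusHom_tElement σ)).symm

theorem snoc_tEntries (σ : Aˣ) (i : Fin (n + 1)) :
    (Fin.snoc (α := fun _ => Aˣ) (tEntries n σ) 1 : Fin (n + 1) → Aˣ) i = σ ^ (n - (i : ℕ)) := by
  refine Fin.lastCases ?_ (fun i => ?_) i <;> simp [tEntries]

theorem wGL_mul_jHom_mul_wGL (σ : Aˣ) :
    wGL (n + 1) A * jHom (diagHom (tEntries n σ)) * wGL (n + 1) A = powGL n σ := by
  rw [jHom_diagHom_tEntries, wGL_conj_diagHom, powGL]
  congr 1
  funext i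
  rw [Function.comp_apply, snoc_tEntries]
  congr 1
  rw [Fin.val_rev]
  omega

/-- The scalar matrix `σ ^ n`. -/
def scalarPow (n : ℕ) (σ : Aˣ) : GL (Fin (n + 1)) A := diagHom fun _ => σ ^ n

theorem powGL_mul_jHom (σ : Aˣ) :
    powGL n σ * jHom (diagHom (tEntries n σ)) = scalarPow n σ := by
  rw [jHom_diagHom_tEntries, powGL, ← map_mul, scalarPow]
  congr 1
  funext i
  rw [Pi.mul_apply, snoc_tEntries, ← pow_add]
  congr 1
  omega

theorem scalarPow_comm (σ : Aˣ) (g : GL (Fin (n + 1)) A) :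
    scalarPow n σ * g = g * scalarPow n σ := by
  ext i j
  change ((diagonal fun _ : Fin (n + 1) => ((σ ^ n : Aˣ) : A)) * g.1 : Matrix _ _ A) i j =
    (g.1 * diagonal fun _ : Fin (n + 1) => ((σ ^ n : Aˣ) : A) : Matrix _ _ A) i j
  rw [diagonal_mul, mul_diagonal, mul_comm]

/-- The element of `GL(n+1)` attached to `h t g`, up to a scalar. -/
def contractedGL (σ : Aˣ) (g : GLPair n A) : GL (Fin (n + 1)) A :=
  (jHom g.2)⁻¹ * powGL n σ * ((sectionGL 1 * diagHom (hSigns n A)) * powGL n σ *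
    (wGL (n + 1) A * g.1 * wGL (n + 1) A))

/-- Up to the scalar σⁿ, both the inverse of t on the left and the w-conjugate of t on the right
equal diag(1, σ, …, σⁿ). So both sides contract in the same direction, with nonnegative powers of σ.
-/
theorem contractedGL_eq (σ : Aˣ) (g : GLPair n A) :
    contractedGL σ g = (jHom (diagHom (tEntries n σ) * g.2))⁻¹ *
      ((hElement n A).1 * jHom (diagHom (tEntries n σ)) * g.1) * wGL (n + 1) A *
        scalarPow n σ := by
  have hw : ∀ x, wGL (n + 1) A * (wGL (n + 1) A * x) = x := fun x => by
    rw [← mul_assoc, wGL_mul_self, one_mul]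
  have h1 : powGL n σ = (jHom (diagHom (tEntries n σ)))⁻¹ * scalarPow n σ := by
    rw [eq_inv_mul_iff_mul_eq, ← powGL_mul_jHom, powGL_mul_jHom, ← powGL_mul_jHom]
    rw [jHom_diagHom_tEntries, powGL, ← map_mul, ← map_mul, mul_comm]
  have h2 : powGL n σ = wGL (n + 1) A * jHom (diagHom (tEntries n σ)) * wGL (n + 1) A :=
    (wGL_mul_jHom_mul_wGL σ).symm
  have h3 : sectionGL 1 * diagHom (hSigns n A) * powGL n σ *
      (wGL (n + 1) A * g.1 * wGL (n + 1) A) =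
      (hElement n A).1 * jHom (diagHom (tEntries n σ)) * g.1 * wGL (n + 1) A := by
    rw [← hElement_fst_mul_wGL, h2]
    simp only [mul_assoc, hw]
  rw [contractedGL, h3, h1, map_mul, _root_.mul_inv_rev]
  simp only [mul_assoc, scalarPow_comm]

theorem contractedGL_val (σ : Aˣ) (g : GLPair n A) : (contractedGL σ g).1 =
    contracted (σ : A) (sectionGL 1 * diagHom (hSigns n A) : GL (Fin (n + 1)) A).1 g.2⁻¹.1
      (wGL (n + 1) A * g.1 * wGL (n + 1) A).1 := by
  rw [contractedGL, contracted, ← powGL_val, ← map_inv]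
  rfl

theorem contractedGL_one_val (σ : Aˣ) : (contractedGL σ (1 : GLPair n A)).1 =
    contracted (σ : A) (sectionGL 1 * diagHom (hSigns n A) : GL (Fin (n + 1)) A).1 1 1 := by
  rw [contractedGL_val]
  congr 1
  rw [Prod.fst_one, mul_one, wGL_mul_self]
  rfl

theorem det_contractedGL (σ : Aˣ) (g : GLPair n A) :
    GeneralLinearGroup.det (contractedGL σ g) =
      GeneralLinearGroup.det (contractedGL σ (1 : GLPair n A)) *
        ((GeneralLinearGroup.det (jHom g.2))⁻¹ * GeneralLinearGroup.det g.1) := by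
  simp only [contractedGL, map_mul, map_inv, Prod.fst_one, Prod.snd_one, map_one, inv_one, one_mul,
    mul_one]
  generalize GeneralLinearGroup.det g.1 = a
  generalize (GeneralLinearGroup.det (jHom g.2))⁻¹ = b
  simp only [mul_assoc, mul_comm a]
  ac_rfl

theorem contracted_map {S : Type*} [CommRing S] (f : A →+* S) (x : A)
    (H : Matrix (Fin (n + 1)) (Fin (n + 1)) A) (G₂ : Matrix (Fin n) (Fin n) A)
    (G₁ : Matrix (Fin (n + 1)) (Fin (n + 1)) A) :
    (contracted x H G₂ G₁).map f = contracted (f x) (H.map f) (G₂.map f) (G₁.map f) := by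
  have h : (powDiag n x).map f = powDiag n (f x) := by
    rw [powDiag, diagonal_map (map_zero f), powDiag]
    simp
  rw [contracted, Matrix.map_mul, Matrix.map_mul, Matrix.map_mul, Matrix.map_mul, h, blocks_map,
    contracted]
  simp

end Contraction

/-! ### Normalized values as integral polynomials -/

section CurveTheorem

open Matrix Polynomial

variable {O E R A V : Type*} [CommRing O] [IsDomain O] [Field E] [Algebra O E] [IsFractionRing O E]
  [CommRing R] [CommRing A] [Algebra E A] [Module.Finite E A] [AddCommGroup V] [Module E V] {n : ℕ}

/-- The minors of the matrix attached to `h t g` are polynomial multiples of those for `g = 1`. -/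
theorem exists_minor_contractedGL_eq (f : R →+* A) (g : GLPair n R) (k r : Fin (n + 1))
    (hr : r = k ∨ r = Fin.last n) : ∃ a : R[X], ∀ s : Eˣ,
      minor (contractedGL (Units.map (algebraMap E A).toMonoidHom s)
        (GeneralLinearGroup.map f g.1, GeneralLinearGroup.map f g.2)).1 k r =
      minor (contractedGL (Units.map (algebraMap E A).toMonoidHom s) (1 : GLPair n A)).1 k r *
        evalCoeff f (s : E) a := by
  -- Division takes place over R[X] with σ replaced by the indeterminate, so the quotient has
  -- coefficients in R. Specializing over A directly would lose integrality, since nonzero scalars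
  -- are units there.
  obtain ⟨a, ha⟩ := exists_minor_contracted_eq (X : R[X]) (hSigns n R[X])
    (g.2⁻¹.1.map C) ((wGL (n + 1) R * g.1 * wGL (n + 1) R).1.map C) k r hr
  refine ⟨a, fun s => ?_⟩
  have hX : evalCoeff f (s : E) X = (Units.map (algebraMap E A).toMonoidHom s : A) :=
    evalCoeff_X f (s : E)
  have hH : (sectionGL 1 * diagHom (hSigns n R[X]) : GL (Fin (n + 1)) R[X]).1.map
      (evalCoeff f (s : E)) = (sectionGL 1 * diagHom (hSigns n A) : GL (Fin (n + 1)) A).1 := by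
    have : GeneralLinearGroup.map (evalCoeff f (s : E)) (sectionGL 1 * diagHom (hSigns n R[X])) =
        sectionGL 1 * diagHom (hSigns n A) := by
      rw [map_mul, sectionGL_map, diagHom_map]
      simp only [hSigns_map, Pi.one_apply, map_one]
      rfl
    exact congrArg Units.val this
  have hC : ∀ {m : ℕ} (M : Matrix (Fin m) (Fin m) R), (M.map C).map (evalCoeff f (s : E)) =
      M.map f := fun M => by
    ext i j
    simp [evalCoeff_C]
  have hw : (wGL (n + 1) R * g.1 * wGL (n + 1) R).1.map f =
      (wGL (n + 1) A * GeneralLinearGroup.map f g.1 * wGL (n + 1) A).1 := by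
    have : GeneralLinearGroup.map f (wGL (n + 1) R * g.1 * wGL (n + 1) R) =
        wGL (n + 1) A * GeneralLinearGroup.map f g.1 * wGL (n + 1) A := by
      rw [map_mul, map_mul, wGL_map]
    exact congrArg Units.val this
  have hi : g.2⁻¹.1.map f = (GeneralLinearGroup.map f g.2)⁻¹.1 := by
    rw [← map_inv]
    rfl
  have h := congrArg (evalCoeff f (s : E)) ha
  rw [map_mul, ← minor_map, ← minor_map, contracted_map, contracted_map, hX, hH, hC, hC, hw, hi,
    Matrix.map_one _ (map_zero _) (map_one _), Matrix.map_one _ (map_zero _) (map_one _)] at h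
  rw [contractedGL_val, contractedGL_one_val]
  exact h

namespace IsLowerCyclic

variable {ρ : Representation E (GLPair n A) V} {χ : Torus n A →* Eˣ} {v₀ : V}
  (h : IsLowerCyclic ρ χ v₀) {j : ℤ} {η : V →ₗ[E] E} (hη : IsNormEquivariant ρ j η)

include h hη

/-- The scalar σⁿ and the torus element contribute constants that are the same for g and for 1. They
cancel when the two values are compared. -/
theorem apply_contractedGL (σ : Aˣ) (g : GLPair n A) :
    η (ρ (hElement n A * torusHom (tElement n σ) * g) v₀) *
        (cellCharacter χ j (1, fun _ => σ ^ n) : Eˣ) =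
      Algebra.norm E (GeneralLinearGroup.det (diagHom (tEntries n σ)) : A) ^ j *
        Algebra.norm E (GeneralLinearGroup.det g.2 : A) ^ j *
          cellFunction ρ v₀ η (contractedGL σ g) := by
  have h1 : hElement n A * torusHom (tElement n σ) * g =
      ((hElement n A).1 * jHom (diagHom (tEntries n σ)) * g.1, diagHom (tEntries n σ) * g.2) := by
    rw [torusHom_tElement]
    refine Prod.ext rfl ?_
    change 1 * diagHom (tEntries n σ) * g.2 = _
    rw [one_mul]
  have h2 := (h.isSemiInvariant hη).torus (1, fun _ => σ ^ n)
    ((jHom (diagHom (tEntries n σ) * g.2))⁻¹ *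
      ((hElement n A).1 * jHom (diagHom (tEntries n σ)) * g.1) * wGL (n + 1) A)
  simp only [map_one, one_mul] at h2
  rw [contractedGL_eq, scalarPow, h2, h.apply_eq hη, h1]
  simp only [map_mul, Units.val_mul, mul_zpow]
  ring

variable [IsNoetherianRing O] [IsIntegrallyClosed O] [Infinite E] {f : R →+* A}
  (hf : HasDenominators O (E := E) f) (h0 : η ≠ 0)

include hf h0

theorem exists_polynomial_of_pow (Y : ℕ → GL (Fin (n + 1)) R[X])
    (hpow : ∀ (k : ℕ) (x : E), cellFunction ρ v₀ η (GeneralLinearGroup.map (evalCoeff f x) (Y k)) =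
      cellFunction ρ v₀ η (rowGL 1) *
        (cellFunction ρ v₀ η (GeneralLinearGroup.map (evalCoeff f x) (Y 1)) /
          cellFunction ρ v₀ η (rowGL 1)) ^ k) :
    ∃ P : O[X], ∀ x : E, cellFunction ρ v₀ η (GeneralLinearGroup.map (evalCoeff f x) (Y 1)) =
      cellFunction ρ v₀ η (rowGL 1) * aeval x P := by
  have he := h.cellFunction_ne_zero hη h0
  obtain ⟨P, hP⟩ := exists_polynomial_of_regular hf
    (h.rational (ρ (wGL (n + 1) A, 1) v₀) ((cellFunction ρ v₀ η (rowGL 1))⁻¹ • η))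
    (fun k => (Y k, 1)) (a := fun x =>
      cellFunction ρ v₀ η (GeneralLinearGroup.map (evalCoeff f x) (Y 1)) /
          cellFunction ρ v₀ η (rowGL 1)) fun k x => by
      rw [LinearMap.smul_apply, smul_eq_mul, map_one]
      change _ * cellFunction ρ v₀ η _ = _
      rw [hpow, inv_mul_cancel_left₀ he]
  exact ⟨P, fun x => by rw [← hP, mul_div_cancel₀ _ he]⟩

theorem exists_polynomial_sectionGL (a : Fin n → R[X]) : ∃ P : O[X], ∀ x : E,
    cellFunction ρ v₀ η (sectionGL fun k => evalCoeff f x (a k)) =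
      cellFunction ρ v₀ η (rowGL 1) * aeval x P := by
  have he := h.cellFunction_ne_zero hη h0
  obtain ⟨P, hP⟩ := h.exists_polynomial_of_pow hη hf h0 (fun k => sectionGL (a ^ k)) fun k x => by
    have h1 : ∀ k, GeneralLinearGroup.map (evalCoeff f x) (sectionGL (a ^ k)) =
        sectionGL ((fun i => evalCoeff f x (a i)) ^ k) := fun k => by
      rw [sectionGL_map]
      congr 1
      funext i
      simp
    simp only [h1]
    simp only [pow_one]
    induction k with
    | zero =>
      -- For k = 0 the matrix is `sectionGL 1`, which has the same minors as the base point `rowGL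
      -- 1`.
      have h2 := (h.isSemiInvariant hη).sectionGL_of_units 1
      have h3 : cellTorus ((1, 1, 1) : (Fin n → Aˣ) × (Fin n → Aˣ) × Aˣ) = 1 := map_one _
      rw [h3, map_one, Units.val_one, one_mul] at h2
      rw [pow_zero, pow_zero, mul_one, ← h2]
      rfl
    | succ k ih =>
      refine mul_right_cancel₀ he ?_
      rw [pow_succ, (h.isSemiInvariant hη).sectionGL_mul (h.isTame η), ih, pow_succ]
      field_simp
  refine ⟨P, fun x => ?_⟩
  rw [← hP, sectionGL_map]
  simp

theorem exists_polynomial_rowGL (a : Fin n → R[X]) : ∃ P : O[X], ∀ x : E,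
    cellFunction ρ v₀ η (rowGL fun k => evalCoeff f x (a k)) =
      cellFunction ρ v₀ η (rowGL 1) * aeval x P := by
  have he := h.cellFunction_ne_zero hη h0
  obtain ⟨P, hP⟩ := h.exists_polynomial_of_pow hη hf h0 (fun k => rowGL (a ^ k)) fun k x => by
    have h1 : ∀ k, GeneralLinearGroup.map (evalCoeff f x) (rowGL (a ^ k)) =
        rowGL ((fun i => evalCoeff f x (a i)) ^ k) := fun k => by
      rw [rowGL_map]
      congr 1
      funext i
      simp
    simp only [h1]
    simp only [pow_one]
    induction k with
    | zero => simp
    | succ k ih =>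
      refine mul_right_cancel₀ he ?_
      rw [pow_succ, (h.isSemiInvariant hη).rowGL_mul (h.isTame η), ih, pow_succ]
      field_simp
  refine ⟨P, fun x => ?_⟩
  rw [← hP, rowGL_map]
  simp

theorem exists_polynomial_lastDiag (δ : Rˣ) : ∃ P : O[X], ∀ x : E,
    cellFunction ρ v₀ η (rowGL 1 * lastDiag n (Units.map f.toMonoidHom δ)) =
      cellFunction ρ v₀ η (rowGL 1) * aeval x P := by
  have he := h.cellFunction_ne_zero hη h0
  have h1 : ∀ (x : E) (k : ℕ), GeneralLinearGroup.map (evalCoeff f x)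
      (rowGL 1 * lastDiag n (Units.map (C : R →+* R[X]).toMonoidHom (δ ^ k))) =
      rowGL 1 * lastDiag n (Units.map f.toMonoidHom δ ^ k) := fun x k => by
    rw [map_mul, rowGL_map, lastDiag_map]
    simp only [Pi.one_apply, map_one, ← map_pow]
    congr 2
    refine Units.ext ?_
    exact evalCoeff_C f x _
  obtain ⟨P, hP⟩ := h.exists_polynomial_of_pow hη hf h0
    (fun k => rowGL 1 * lastDiag n (Units.map (C : R →+* R[X]).toMonoidHom (δ ^ k)))
    fun k x => by
    simp only [h1]
    simp only [pow_one]
    induction k with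
    | zero => simp
    | succ k ih =>
      refine mul_right_cancel₀ he ?_
      rw [pow_succ, (h.isSemiInvariant hη).lastDiag_mul, ih, pow_succ]
      field_simp
  refine ⟨P, fun x => ?_⟩
  rw [← hP, h1, pow_one]

/-- The normalized value of `η` at `h t g v₀` is an integral polynomial in the parameter of `t`. -/
theorem exists_polynomial (g : GLPair n R) : ∃ P : O[X], ∀ s : Eˣ,
    η (ρ (hElement n A * torusHom (tElement n (Units.map (algebraMap E A).toMonoidHom s)) *
      (GeneralLinearGroup.map f g.1, GeneralLinearGroup.map f g.2)) v₀) =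
    χ (tElement n (Units.map (algebraMap E A).toMonoidHom s)) * η (ρ (hElement n A) v₀) *
      aeval (s : E) P := by
  have he := h.cellFunction_ne_zero hη h0
  choose a ha using fun k : Fin n =>
    exists_minor_contractedGL_eq (E := E) f g k.castSucc k.castSucc (Or.inl rfl)
  choose b hb using fun k : Fin n =>
    exists_minor_contractedGL_eq (E := E) f g k.castSucc (Fin.last n) (Or.inr rfl)
  let δ : Rˣ := (GeneralLinearGroup.det (jHom g.2))⁻¹ * GeneralLinearGroup.det g.1
  obtain ⟨P, hP⟩ := h.exists_polynomial_sectionGL hη hf h0 a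
  obtain ⟨Q, hQ⟩ := h.exists_polynomial_rowGL hη hf h0 b
  obtain ⟨D, hD⟩ := h.exists_polynomial_lastDiag hη hf h0 δ
  -- The determinant is a unit of R, so its j-th power lies in R and has integral norm even for
  -- negative j.
  obtain ⟨o, ho⟩ := exists_norm_eq hf (↑(GeneralLinearGroup.det g.2 ^ j) : R)
  refine ⟨P * Q * D * C o, fun s => ?_⟩
  set σ := Units.map (algebraMap E A).toMonoidHom s with hσ
  set g' : GLPair n A := (GeneralLinearGroup.map f g.1, GeneralLinearGroup.map f g.2) with hg'
  have hδ : Units.map f.toMonoidHom δ =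
      (GeneralLinearGroup.det (jHom g'.2))⁻¹ * GeneralLinearGroup.det g'.1 := by
    simp only [δ, g', ← jHom_map, GeneralLinearGroup.map_det]
    rw [map_mul, map_inv]
    rfl
  have hnorm : Algebra.norm E (GeneralLinearGroup.det g'.2 : A) ^ j = algebraMap O E o := by
    rw [← ho]
    have h1 : Units.map (Algebra.norm E) (GeneralLinearGroup.det g'.2) ^ j =
        Units.map (Algebra.norm E) (Units.map f.toMonoidHom (GeneralLinearGroup.det g.2 ^ j)) := by
      rw [map_zpow, map_zpow]
      congr 2
      exact GeneralLinearGroup.map_det f g.2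
    have h2 := congrArg Units.val h1
    rwa [Units.val_zpow_eq_zpow_val] at h2
  -- The point for g is compared with the point for 1, where η is known because t acts on v₀ by a
  -- scalar.
  have key := (h.isSemiInvariant hη).mul_pow_three_eq (h.isTame η) he
    (fun k => ha k s) (fun k => hb k s) (det_contractedGL σ g')
  rw [hP, hQ, ← hδ, hD (s : E)] at key
  have h1 := h.apply_contractedGL hη σ g'
  have h2 := h.apply_contractedGL hη σ 1
  have h3 : ρ (hElement n A * torusHom (tElement n σ) * 1) v₀ =
      (χ (tElement n σ) : E) • ρ (hElement n A) v₀ := by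
    rw [mul_one, map_mul, Module.End.mul_apply, h.torus, map_smul]
  rw [h3, map_smul, smul_eq_mul, Prod.snd_one, map_one, Units.val_one, map_one, _root_.one_zpow,
    mul_one] at h2
  rw [hnorm] at h1
  have hψ : ((cellCharacter χ j (1, fun _ => σ ^ n) : Eˣ) : E) ≠ 0 := Units.ne_zero _
  refine mul_right_cancel₀ hψ (mul_right_cancel₀ (pow_ne_zero 3 he) ?_)
  rw [h1, map_mul, map_mul, map_mul, aeval_C]
  linear_combination (Algebra.norm E (GeneralLinearGroup.det (diagHom (tEntries n σ)) : A) ^ j *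
    algebraMap O E o) * key - (aeval (s : E) P * aeval (s : E) Q * aeval (s : E) D *
    algebraMap O E o * cellFunction ρ v₀ η (rowGL 1) ^ 3) * h2

end IsLowerCyclic

end CurveTheorem

/-! ### Contraction of V to the line of v₀ -/

section Limits

open Matrix Filter Polynomial

variable {E A V : Type*} [Field E] [CommRing A] [Algebra E A] [Module.Finite E A]
  [AddCommGroup V] [Module E V] {n m : ℕ}

/-- The element `t_s` of the torus attached to a nonzero scalar `s`. -/
noncomputable def scalarTorus (n : ℕ) (A : Type*) [CommRing A] [Algebra E A] (s : Eˣ) : Torus n A :=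
  tElement n (Units.map (algebraMap E A).toMonoidHom s)

/-- The conjugate of an upper unipotent matrix by `diag(s^m, …, s)`. -/
noncomputable def contractUpper (u : GL (Fin m) A) (hu : IsUpperUnipotent u) (s : E) :
    GL (Fin m) A :=
  GeneralLinearGroup.mk'' (of fun i j => s ^ ((j : ℕ) - (i : ℕ)) • u i j) (by
    -- The truncated exponent j - i is harmless, because the entries below the diagonal vanish.
    have h (i j : Fin m) (hij : j < i) : s ^ ((j : ℕ) - (i : ℕ)) • u i j = 0 := by
      rw [(hu _ _).2 hij, smul_zero]
    have h' : IsUpperTriangular (of fun i j : Fin m => s ^ ((j : ℕ) - (i : ℕ)) • u i j) :=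
      fun i j hij => h i j hij
    rw [det_of_isUpperTriangular h']
    simp [(hu _ _).1 rfl])

theorem contractUpper_apply {u : GL (Fin m) A} (hu : IsUpperUnipotent u) (s : E) (i j : Fin m) :
    contractUpper u hu s i j = s ^ ((j : ℕ) - (i : ℕ)) • u i j := rfl

theorem contractUpper_zero {u : GL (Fin m) A} (hu : IsUpperUnipotent u) :
    contractUpper u hu (0 : E) = 1 := by
  ext i j
  rw [contractUpper_apply, Units.val_one, one_apply]
  rcases lt_trichotomy i j with h | rfl | h
  · rw [zero_pow (by have := Fin.lt_def.1 h; omega), zero_smul, if_neg h.ne]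
  · simp [(hu _ _).1 rfl]
  · rw [(hu _ _).2 h, smul_zero, if_neg h.ne']

theorem entriesIn_contractUpper {u : GL (Fin m) A} (hu : IsUpperUnipotent u) :
    EntriesIn (rationalFunctionsAtZero E) (contractUpper (E := E) u hu) :=
  entriesIn_of_entries fun _ _ => coordSubalgebra_mono polynomialFunctions_le
    (smul_mem_coordSubalgebra (pow_mem id_mem_polynomialFunctions _) _)

/-- With N = n this covers both components of t_s, of sizes n + 1 and n. The bound on m makes N - j
free of truncation. -/
theorem diagHom_mul_upper {u : GL (Fin m) A} (hu : IsUpperUnipotent u) (s : Eˣ)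
    (t : Fin m → Aˣ) (N : ℕ) (hN : m ≤ N + 1)
    (ht : ∀ i, t i = Units.map (algebraMap E A).toMonoidHom s ^ (N - (i : ℕ))) :
    diagHom t * u = contractUpper u hu (s : E) * diagHom t := by
  ext i j
  change ((diagHom t).1 * u.1) i j = ((contractUpper u hu (s : E)).1 * (diagHom t).1) i j
  rw [diagHom_val, diagonal_mul, mul_diagonal, contractUpper_apply]
  rcases lt_or_ge j i with h | h
  · rw [(hu _ _).2 h, smul_zero, zero_mul, mul_zero]
  · have h1 : N - (i : ℕ) = ((j : ℕ) - (i : ℕ)) + (N - (j : ℕ)) := by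
      have := Fin.le_def.1 h
      omega
    rw [ht, ht, h1, pow_add, Algebra.smul_def]
    simp only [Units.val_mul, Units.val_pow_eq_pow_val, Units.coe_map, RingHom.toMonoidHom_eq_coe,
      MonoidHom.coe_coe, map_pow]
    ring

theorem torusHom_scalarTorus_mul {u : GLPair n A} (h₁ : IsUpperUnipotent u.1)
    (h₂ : IsUpperUnipotent u.2) (s : Eˣ) :
    torusHom (scalarTorus n A s) * u =
      (contractUpper u.1 h₁ (s : E), contractUpper u.2 h₂ (s : E)) *
        torusHom (scalarTorus n A s) :=
  Prod.ext
    (diagHom_mul_upper h₁ s _ n le_rfl fun i => snoc_tEntries _ i)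
    (diagHom_mul_upper h₂ s _ n (Nat.le_succ n) fun _ => rfl)

theorem eq_upper_mul_diagonal_mul_lower {Y : GL (Fin m) A} (h : ∀ k, IsUnit (minor Y.1 k k)) :
    ∃ (u : GL (Fin m) A) (t : Fin m → Aˣ) (b : GL (Fin m) A), IsUpperUnipotent u ∧
      IsLowerUnipotent b ∧ wGL m A * Y * wGL m A = u * diagHom t * b := by
  obtain ⟨L, t, U, hL, hU, hY, -⟩ := exists_lower_mul_diagonal_mul_upper Y h
  refine ⟨_, t ∘ Fin.rev, _, wGL_conj_lower hL, wGL_conj_upper hU, ?_⟩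
  have hw : ∀ x, wGL m A * (wGL m A * x) = x := fun x => by
    rw [← mul_assoc, wGL_mul_self, one_mul]
  rw [hY, ← wGL_conj_diagHom]
  simp only [mul_assoc, hw]

/-- A tame function that vanishes where all leading principal minors are units is zero. -/
theorem IsTame.eq_zero_of_minors [Infinite E] {Φ : GL (Fin m) A → E} (hΦ : IsTame E Φ)
    (h : ∀ Y : GL (Fin m) A, (∀ k, IsUnit (minor Y.1 k k)) → Φ Y = 0) (Y : GL (Fin m) A) :
    Φ Y = 0 :=
  hΦ.eq_zero (fun k Y => minor Y k k) (fun k _ hZ => minor_mem hZ k k) 1 (fun k => by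
    have h1 := minor_of_lower (1 : GL (Fin m) A).1 isLowerUnipotent_one k k
    rw [(isLowerUnipotent_one _ _).1 rfl] at h1
    exact h1 ▸ isUnit_one) h Y

namespace IsLowerCyclic

variable {ρ : Representation E (GLPair n A) V} {χ : Torus n A →* Eˣ} {v₀ : V}

/-- The orbit of `v₀` under the upper unipotent radical spans `V`. -/
theorem span_upper [Infinite E] (h : IsLowerCyclic ρ χ v₀) :
    Submodule.span E {w | ∃ u : GLPair n A, IsUpperUnipotent u.1 ∧ IsUpperUnipotent u.2 ∧
      ρ u v₀ = w} = ⊤ := by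
  by_contra hne
  obtain ⟨l, hl0, hl⟩ := Submodule.exists_le_ker_of_lt_top _ (lt_top_iff_ne_top.2 hne)
  have hu : ∀ u : GLPair n A, IsUpperUnipotent u.1 → IsUpperUnipotent u.2 → l (ρ u v₀) = 0 :=
    fun u h₁ h₂ => hl (Submodule.subset_span ⟨u, h₁, h₂, rfl⟩)
  -- A functional vanishing on U v₀ vanishes on U T U⁻ v₀. Conjugation by w turns this into a
  -- condition on leading minors, and density is applied in one component at a time.
  have key : ∀ (Y₂ : GL (Fin n) A) (Y₁ : GL (Fin (n + 1)) A),
      l (ρ (wGL (n + 1) A * Y₁ * wGL (n + 1) A, wGL n A * Y₂ * wGL n A) v₀) = 0 := by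
    intro Y₂ Y₁
    refine IsTame.eq_zero_of_minors (E := E) (Φ := fun Y₂ =>
      l (ρ (wGL (n + 1) A * Y₁ * wGL (n + 1) A, wGL n A * Y₂ * wGL n A) v₀))
      (fun Z hZ => comp_mem_of_mem_regularAlgebra
        (μ := fun x => (wGL (n + 1) A * Y₁ * wGL (n + 1) A, wGL n A * Z x * wGL n A))
        (EntriesIn.const _ _) (((EntriesIn.const _ _).mul hZ).mul (EntriesIn.const _ _))
        (h.rational _ _)) (fun Y₂ hY₂ => ?_) Y₂
    refine IsTame.eq_zero_of_minors (E := E) (Φ := fun Y₁ =>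
      l (ρ (wGL (n + 1) A * Y₁ * wGL (n + 1) A, wGL n A * Y₂ * wGL n A) v₀))
      (fun Z hZ => comp_mem_of_mem_regularAlgebra
        (μ := fun x => (wGL (n + 1) A * Z x * wGL (n + 1) A, wGL n A * Y₂ * wGL n A))
        (((EntriesIn.const _ _).mul hZ).mul (EntriesIn.const _ _)) (EntriesIn.const _ _)
        (h.rational _ _)) (fun Y₁ hY₁ => ?_) Y₁
    obtain ⟨u₁, t₁, b₁, hu₁, hb₁, he₁⟩ := eq_upper_mul_diagonal_mul_lower hY₁
    obtain ⟨u₂, t₂, b₂, hu₂, hb₂, he₂⟩ := eq_upper_mul_diagonal_mul_lower hY₂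
    have hfac : (u₁ * diagHom t₁ * b₁, u₂ * diagHom t₂ * b₂) =
        ((u₁, u₂) * torusHom (t₁, t₂) * (b₁, b₂) : GLPair n A) := rfl
    rw [he₁, he₂, hfac, map_mul, Module.End.mul_apply, h.unipotent _ hb₁ hb₂, map_mul,
      Module.End.mul_apply, h.torus, map_smul, map_smul, hu _ hu₁ hu₂, smul_zero]
  refine hl0 (h.cyclic l fun g => ?_)
  have hw : ∀ {m : ℕ} (g : GL (Fin m) A), wGL m A * (wGL m A * g * wGL m A) * wGL m A = g :=
    fun g => by
      rw [mul_assoc, mul_assoc _ (wGL _ A) (wGL _ A), wGL_mul_self, mul_one, ← mul_assoc,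
        wGL_mul_self, one_mul]
  have h1 := key (wGL n A * g.2 * wGL n A) (wGL (n + 1) A * g.1 * wGL (n + 1) A)
  rwa [hw, hw] at h1

open Classical in
/-- As `s` tends to `0`, the normalized action of `t_s` converges to a projection to the line
of `v₀`. -/
theorem exists_limit [Infinite E] (h : IsLowerCyclic ρ χ v₀) (w : V) : ∃ Ω : E, ∀ l : V →ₗ[E] E,
    (fun s : E => if hs : s = 0 then Ω * l v₀ else
      ((χ (scalarTorus n A (Units.mk0 s hs)))⁻¹ : Eˣ) *
        l (ρ (torusHom (scalarTorus n A (Units.mk0 s hs))) w)) ∈ rationalFunctionsAtZero E := by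
  have hw : w ∈ Submodule.span E {w | ∃ u : GLPair n A, IsUpperUnipotent u.1 ∧
      IsUpperUnipotent u.2 ∧ ρ u v₀ = w} := h.span_upper ▸ Submodule.mem_top
  induction hw using Submodule.span_induction with
  | mem w hw =>
    obtain ⟨u, h₁, h₂, rfl⟩ := hw
    -- The matrix t_s u t_s⁻¹ is polynomial in s and equals 1 at s = 0, so the limit is v₀ itself.
    -- The factor χ(t_s) is removed by the normalization.
    refine ⟨1, fun l => ?_⟩
    have := comp_mem_of_mem_regularAlgebra
      (μ := fun s : E => (contractUpper u.1 h₁ s, contractUpper u.2 h₂ s))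
      (entriesIn_contractUpper h₁) (entriesIn_contractUpper h₂) (h.rational v₀ l)
    refine cast (congrArg (· ∈ _) ?_) this
    funext s
    split_ifs with hs
    · rw [hs, contractUpper_zero, contractUpper_zero, one_mul]
      change l (ρ 1 v₀) = _
      rw [map_one, Module.End.one_apply]
    · rw [← Module.End.mul_apply, ← map_mul, torusHom_scalarTorus_mul h₁ h₂, map_mul,
        Module.End.mul_apply, h.torus, map_smul, map_smul, smul_eq_mul, Units.inv_mul_cancel_left]
      rfl
  | zero =>
    refine ⟨0, fun l => ?_⟩
    refine cast (congrArg (· ∈ _) ?_) (zero_mem (rationalFunctionsAtZero E))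
    funext s
    simp
  | add w w' _ _ hw hw' =>
    obtain ⟨Ω, hΩ⟩ := hw
    obtain ⟨Ω', hΩ'⟩ := hw'
    refine ⟨Ω + Ω', fun l => cast (congrArg (· ∈ _) ?_) (add_mem (hΩ l) (hΩ' l))⟩
    funext s
    rw [Pi.add_apply]
    split_ifs with hs
    · ring
    · rw [map_add, map_add, mul_add]
  | smul c w _ hw =>
    obtain ⟨Ω, hΩ⟩ := hw
    refine ⟨c * Ω, fun l => cast (congrArg (· ∈ _) ?_) (Subalgebra.smul_mem _ (hΩ l) c)⟩
    funext s
    rw [Pi.smul_apply, smul_eq_mul]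
    split_ifs with hs
    · ring
    · rw [map_smul, map_smul, smul_eq_mul]
      ring

variable {O R : Type*} [CommRing O] [IsDomain O] [Algebra O E] [IsFractionRing O E] [CommRing R]

/-- The constant terms of the polynomials that describe the normalized values of the equivariant
functionals do not depend on the functional. -/
theorem exists_common_polynomial [Infinite E] [IsNoetherianRing O] [IsIntegrallyClosed O]
    (h : IsLowerCyclic ρ χ v₀) {f : R →+* A} (hf : HasDenominators O (E := E) f)
    (g : GLPair n R) : ∃ Ω : O, ∀ (j : ℤ) (η : V →ₗ[E] E), IsNormEquivariant ρ j η → η ≠ 0 →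
      ∃ P : O[X], P.eval 0 = Ω ∧ ∀ s : Eˣ,
        ((χ (scalarTorus n A s))⁻¹ : Eˣ) *
          η (ρ (hElement n A * torusHom (scalarTorus n A s) *
            (GeneralLinearGroup.map f g.1, GeneralLinearGroup.map f g.2)) v₀) =
        η (ρ (hElement n A) v₀) * aeval (s : E) P := by
  obtain ⟨ω, hω⟩ := h.exists_limit
    (ρ (GeneralLinearGroup.map f g.1, GeneralLinearGroup.map f g.2) v₀)
  have key : ∀ (j : ℤ) (η : V →ₗ[E] E), IsNormEquivariant ρ j η → η ≠ 0 →
      ∃ P : O[X], algebraMap O E (P.eval 0) = ω ∧ ∀ s : Eˣ,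
        ((χ (scalarTorus n A s))⁻¹ : Eˣ) *
          η (ρ (hElement n A * torusHom (scalarTorus n A s) *
            (GeneralLinearGroup.map f g.1, GeneralLinearGroup.map f g.2)) v₀) =
        η (ρ (hElement n A) v₀) * aeval (s : E) P := fun j η hη h0 => by
    obtain ⟨P, hP⟩ := h.exists_polynomial hη hf h0 g
    have hP' : ∀ s : Eˣ, ((χ (scalarTorus n A s))⁻¹ : Eˣ) *
          η (ρ (hElement n A * torusHom (scalarTorus n A s) *
            (GeneralLinearGroup.map f g.1, GeneralLinearGroup.map f g.2)) v₀) =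
        η (ρ (hElement n A) v₀) * aeval (s : E) P := fun s => by
      rw [scalarTorus, hP, mul_assoc, Units.inv_mul_cancel_left]
    refine ⟨P, ?_, hP'⟩
    have hH := h.apply_hElement_ne_zero hη h0
    have h1 := hω (η ∘ₗ ρ (hElement n A))
    have h2 : (fun s : E => η (ρ (hElement n A) v₀) * aeval s P) ∈ rationalFunctionsAtZero E :=
      Subalgebra.smul_mem _ (polynomialFunctions_le (mem_polynomialFunctions.2
        ⟨P.map (algebraMap O E), fun x => (eval_map_algebraMap P x).symm⟩)) _
    -- The limit function and the polynomial agree for s ≠ 0. Both are regular at 0, so they agree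
    -- there, and cancelling η(h v₀) identifies P(0) with ω.
    have h3 := eq_zero_of_eventually_cofinite (sub_mem h1 h2) (by
      filter_upwards [(Set.finite_singleton (0 : E)).compl_mem_cofinite] with s hs
      have hs0 : s ≠ 0 := hs
      rw [Pi.sub_apply, dif_neg hs0]
      have h4 := hP' (Units.mk0 s hs0)
      rw [map_mul, map_mul, Module.End.mul_apply, Module.End.mul_apply] at h4
      exact sub_eq_zero.2 h4)
    rw [Pi.sub_apply, dif_pos rfl, sub_eq_zero, mul_comm, LinearMap.comp_apply] at h3
    have h5 := mul_left_cancel₀ hH h3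
    rw [h5, ← coe_aeval_eq_eval, ← aeval_algebraMap_apply, map_zero]
  -- Integrality of ω is known only through some nonzero equivariant functional. If there is none,
  -- any constant will do.
  by_cases hex : ∃ (j : ℤ) (η : V →ₗ[E] E), IsNormEquivariant ρ j η ∧ η ≠ 0
  · obtain ⟨j, η, hη, h0⟩ := hex
    obtain ⟨P, hP, -⟩ := key j η hη h0
    refine ⟨P.eval 0, fun j' η' hη' h0' => ?_⟩
    obtain ⟨P', hP', h1⟩ := key j' η' hη' h0'
    exact ⟨P', IsFractionRing.injective O E (hP'.trans hP.symm), h1⟩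
  · push Not at hex
    exact ⟨0, fun j η hη h0 => absurd (hex j η hη) h0⟩

end IsLowerCyclic

end Limits

/-! ### The congruence on the translated lattice -/

section Congruence

open Matrix Polynomial

variable {p : ℕ} [Fact p.Prime] {F E V : Type*} [Field F] [NumberField F] [Field E]
  [Algebra ℚ_[p] E] [FiniteDimensional ℚ_[p] E] [Algebra ℤ_[p] E] [IsScalarTower ℤ_[p] ℚ_[p] E]
  [AddCommGroup V] [Module E V] {n : ℕ} {wt : Weight n F E}
  {ρ : Representation E (GPoints n F E) V} {v₀ : V}

/-- For cyclicity: the vectors v with l(g v) = 0 for all g form a subrepresentation. It contains v₀,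
so by irreducibility it is everything. -/
theorem IsIrreducibleOfHighestWeight.isLowerCyclic (hρ : IsIrreducibleOfHighestWeight ρ wt)
    (hv₀ : IsOppositeHighestWeightVector ρ wt v₀) : IsLowerCyclic ρ wt.conj v₀ where
  unipotent := hv₀.unipotent
  torus := hv₀.torus
  rational := hρ.rational
  cyclic l hl := by
    have := hρ.irreducible
    let W : Subrepresentation ρ :=
      { toSubmodule := ⨅ g, LinearMap.ker (l ∘ₗ ρ g)
        apply_mem_toSubmodule := fun g v hv => by
          rw [Submodule.mem_iInf] at hv ⊢
          intro g'
          have := hv (g' * g)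
          rw [map_mul] at this
          exact this }
    have hW : v₀ ∈ W.toSubmodule := (Submodule.mem_iInf _).2 hl
    have htop : W = ⊤ := (eq_bot_or_eq_top W).resolve_left fun hbot => by
      rw [hbot] at hW
      exact hv₀.ne_zero hW
    ext v
    have hv : v ∈ W.toSubmodule := htop ▸ Submodule.mem_top
    have := (Submodule.mem_iInf _).1 hv 1
    rwa [map_one] at this

theorem tElement_pow {R : Type*} [CommRing R] (x : Rˣ) (α : ℕ) :
    tElement n x ^ α = tElement n (x ^ α) := by
  refine Prod.ext (funext fun i => ?_) (funext fun i => ?_)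
  · change (Fin.snoc (α := fun _ => Rˣ) (tEntries n x) 1 : Fin (n + 1) → Rˣ) i ^ α =
      (Fin.snoc (α := fun _ => Rˣ) (tEntries n (x ^ α)) 1 : Fin (n + 1) → Rˣ) i
    rw [snoc_tEntries, snoc_tEntries, pow_right_comm]
  · exact pow_right_comm _ _ _

theorem natCast_prime_ne_zero (p : ℕ) [Fact p.Prime] (E : Type*) [Field E] [Algebra ℚ_[p] E] :
    (p : E) ≠ 0 := by
  have : CharZero E := charZero_of_injective_algebraMap (algebraMap ℚ_[p] E).injective
  exact Nat.cast_ne_zero.2 (Fact.out : p.Prime).ne_zero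

theorem pUnit_pow (α : ℕ) : pUnit p F E ^ α =
    Units.map (algebraMap E (Coeff F E)).toMonoidHom
      (Units.mk0 ((p : E) ^ α) (pow_ne_zero α (natCast_prime_ne_zero p E))) := by
  refine Units.ext ?_
  change algebraMap E (Coeff F E) (algebraMap ℚ_[p] E p) ^ α =
    algebraMap E (Coeff F E) ((p : E) ^ α)
  rw [map_natCast, map_pow]

theorem apply_dIntegral (hn : 1 ≤ n) {j : ℤ} {η : V →ₗ[E] E} (hη : IsEquivariant ρ j η)
    (x : (Coeff F (valuationRing p E))ˣ) (v : V) :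
    η (ρ (dIntegral p n x) v) = normX p x ^ j * η v := by
  refine (hη _ v).trans ?_
  congr 2
  rw [normH, normX]
  congr 1
  rw [diagHom_val, det_diagonal]
  obtain ⟨m, rfl⟩ := Nat.exists_eq_add_of_le' hn
  rw [Fin.prod_univ_succ]
  simp

/-- For negative j the integrality comes from applying the norm bound to x^j, which again lies in 𝒪
⊗ 𝓞 F because x is a unit. -/
theorem exists_normX_zpow_eq (x : (Coeff F (valuationRing p E))ˣ) (j : ℤ) :
    ∃ o : valuationRing p E, normX p x ^ j = o := by
  have := isFractionRing_valuationRing p E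
  have := isNoetherianRing_valuationRing p E
  have := isIntegrallyClosed_valuationRing p E
  have := infinite_of_padic p E
  obtain ⟨o, ho⟩ := exists_norm_eq (hasDenominators_integralCoeff p F E)
    (↑(x ^ j) : Coeff F (valuationRing p E))
  refine ⟨o, Eq.trans ?_ ho⟩
  have h1 : Units.map (Algebra.norm E) (Units.map (integralCoeff p F E).toMonoidHom x) ^ j =
      Units.map (Algebra.norm E) (Units.map (integralCoeff p F E).toMonoidHom (x ^ j)) := by
    rw [map_zpow, map_zpow]
  have h2 := congrArg Units.val h1
  rwa [Units.val_zpow_eq_zpow_val] at h2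

/-- The values of the equivariant functionals on the contracted lattice are congruent to a common
multiple of their values at the base point. -/
theorem exists_congruence_of_mem_lattice (h : IsLowerCyclic ρ wt.conj v₀) (α : ℕ) {w : V}
    (hw : w ∈ lattice p ρ v₀) : ∃ Ω : valuationRing p E, ∀ (j : ℤ) (η : V →ₗ[E] E),
      IsEquivariant ρ j η → η ≠ 0 → ∃ c : valuationRing p E,
        η (ρ (hElement n (Coeff F E)) (bullet ρ wt (tElement n (pUnit p F E) ^ α) w)) =
          ((Ω + c * (p : valuationRing p E) ^ α : valuationRing p E) : E) *
            η (ρ (hElement n (Coeff F E)) v₀) := by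
  have := isFractionRing_valuationRing p E
  have := isNoetherianRing_valuationRing p E
  have := isIntegrallyClosed_valuationRing p E
  have := infinite_of_padic p E
  induction hw using Submodule.span_induction with
  | mem w hw =>
    obtain ⟨g, rfl⟩ := hw
    obtain ⟨Ω, hΩ⟩ := h.exists_common_polynomial (hasDenominators_integralCoeff p F E) g
    refine ⟨Ω, fun j η hη h0 => ?_⟩
    obtain ⟨P, hP0, hP⟩ := hΩ j η hη h0
    -- P(p^α) - P(0) is divisible by p^α in 𝒪. Only the quotient c depends on η; the constant P(0) =
    -- Ω does not.
    obtain ⟨c, hc⟩ := sub_dvd_eval_sub ((p : valuationRing p E) ^ α) 0 P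
    refine ⟨c, ?_⟩
    have h1 := hP (Units.mk0 ((p : E) ^ α) (pow_ne_zero α (natCast_prime_ne_zero p E)))
    rw [scalarTorus, ← pUnit_pow, ← tElement_pow, map_mul, map_mul, Module.End.mul_apply,
      Module.End.mul_apply] at h1
    have h2 : (p : E) ^ α = algebraMap (valuationRing p E) E ((p : valuationRing p E) ^ α) := by
      simp
    rw [Units.val_mk0, h2, aeval_algebraMap_apply, coe_aeval_eq_eval] at h1
    rw [sub_zero, hP0, sub_eq_iff_eq_add'] at hc
    rw [bullet, LinearMap.smul_apply, map_smul, map_smul, smul_eq_mul]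
    refine h1.trans ?_
    rw [hc, mul_comm, mul_comm c]
    rfl
  | zero => exact ⟨0, fun j η _ _ => ⟨0, by simp⟩⟩
  | add w w' _ _ hw hw' =>
    obtain ⟨Ω, hΩ⟩ := hw
    obtain ⟨Ω', hΩ'⟩ := hw'
    refine ⟨Ω + Ω', fun j η hη h0 => ?_⟩
    obtain ⟨c, hc⟩ := hΩ j η hη h0
    obtain ⟨c', hc'⟩ := hΩ' j η hη h0
    refine ⟨c + c', ?_⟩
    rw [map_add, map_add, map_add, hc, hc']
    push_cast
    ring
  | smul a w _ hw =>
    obtain ⟨Ω, hΩ⟩ := hw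
    refine ⟨a * Ω, fun j η hη h0 => ?_⟩
    obtain ⟨c, hc⟩ := hΩ j η hη h0
    refine ⟨a * c, ?_⟩
    rw [Subalgebra.smul_def, map_smul, map_smul, map_smul, hc, smul_eq_mul]
    push_cast
    ring

end Congruence

end ManinCongruence

open ManinCongruence in
theorem mainTheorem11 (p : ℕ) [Fact p.Prime] (F : Type*) [Field F] [NumberField F]
    (E : Type*) [Field E] [Algebra ℚ_[p] E] [FiniteDimensional ℚ_[p] E]
    [Algebra ℤ_[p] E] [IsScalarTower ℤ_[p] ℚ_[p] E]
    (n : ℕ) (hn : 1 ≤ n)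
    (V : Type*) [AddCommGroup V] [Module E V]
    (wt : Weight n F E) (ρ : Representation E (GPoints n F E) V)
    (hρ : IsIrreducibleOfHighestWeight ρ wt)
    (v₀ : V) (hv₀ : IsOppositeHighestWeightVector ρ wt v₀)
    (x : (Coeff F (valuationRing p E))ˣ) (α : ℕ)
    (v : V) (hv : v ∈ translatedLattice p ρ wt v₀ x α) :
    ∃ Ω : valuationRing p E,
      (∀ (j : ℤ) (η : V →ₗ[E] E), η ≠ 0 → IsEquivariant ρ j η →
        η (ρ (hElement n (Coeff F E)) v₀) ≠ 0 ∧
        η v - normX p x ^ j * (Ω : E) * η (ρ (hElement n (Coeff F E)) v₀) ∈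
          Submodule.span (valuationRing p E)
            {(p : E) ^ α * η (ρ (hElement n (Coeff F E)) v₀)}) ∧
      (v = ρ (dIntegral p n x * hElement n (Coeff F E)) v₀ → Ω = 1) := by
  have h := hρ.isLowerCyclic hv₀
  have := infinite_of_padic p E
  -- For this vector the congruence is an equality with Ω = 1, for every j and η. The normalization
  -- can therefore be imposed by choice, without comparing it with the general construction.
  by_cases hv1 : v = ρ (dIntegral p n x * hElement n (Coeff F E)) v₀
  · refine ⟨1, fun j η h0 hη => ⟨h.apply_hElement_ne_zero hη h0, ?_⟩, fun _ => rfl⟩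
    have h1 : η v - normX p x ^ j * ((1 : valuationRing p E) : E) *
        η (ρ (hElement n (Coeff F E)) v₀) = 0 := by
      rw [hv1, map_mul, Module.End.mul_apply, apply_dIntegral hn hη, OneMemClass.coe_one, mul_one,
        sub_self]
    exact h1 ▸ Submodule.zero_mem _
  · obtain ⟨w, hw, rfl⟩ := hv
    obtain ⟨Ω, hΩ⟩ := exists_congruence_of_mem_lattice h α hw
    refine ⟨Ω, fun j η h0 hη => ⟨h.apply_hElement_ne_zero hη h0, ?_⟩, fun h1 => absurd h1 hv1⟩
    obtain ⟨c, hc⟩ := hΩ j η hη h0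
    obtain ⟨o, ho⟩ := exists_normX_zpow_eq x j
    -- The error c p^α is multiplied by N(x)^j = o, which stays in 𝒪.
    refine Submodule.mem_span_singleton.2 ⟨o * c, ?_⟩
    rw [LinearMap.coe_restrictScalars, LinearMap.comp_apply, map_mul, Module.End.mul_apply,
      apply_dIntegral hn hη, hc, ho, Subalgebra.smul_def, smul_eq_mul]
    push_cast
    ring
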